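/- Let $\Omega\subset\mathbb R^N$ be open, let $f_1,\dots,f_M:\Omega\to\mathbb R$ be of class $C^3$ with gradients $\nabla f_1(\mathbf x),\dots,\nabla f_M(\mathbf x)$ linearly independent at every $\mathbf x\in\Omega$, and let $v_1,\dots,v_M\in\mathbb R$ be reference values. For $\mathbf x\in\Omega$ let $\mathbf g_m(\mathbf x)$ be the orthogonal projection of $\nabla f_m(\mathbf x)$ onto the orthogonal complement of $\operatorname{span}\{\nabla f_1(\mathbf x),\dots,\nabla f_{m-1}(\mathbf x)\}$ (the tangent space of the reference manifold of $f_1,\dots,f_{m-1}$). The narrow path algorithm started at $\mathbf x\in\Omega$ sets $\hat{\mathbf x}_0=\mathbf x$ and, for $m=1,\dots,M-1$, follows the solution of $\mathbf y'=\mathbf g_m(\mathbf y)$, $\mathbf y(0)=\hat{\mathbf x}_{m-1}$, inside $\Omega$ (forwards or backwards in time) until $f_m(\mathbf y)=v_m$; the point reached is $\hat{\mathbf x}_m=\hat{\mathbf x}_m(\mathbf x)$. Let $\Omega^*\subset\Omega$ be the set of points from which all $M-1$ steps can be carried out, and on $\Omega^*$ put $\hat f_j(\mathbf x)=f_j(\hat{\mathbf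 x}_{j-1}(\mathbf x))$, $j=1,\dots,M$ (so $\hat f_1=f_1$). A finite family of functions satisfies the Frobenius condition on a set if at each point of the set the commutator $XY-YX$ of the gradient fields $X,Y$ of any two of its members lies in the span of the gradients of its members. Two functions are decoupled on a set if at each point of the set both are differentiable and their gradients are orthogonal. Let $k\le M$. Suppose that $\mathcal S_k=\{f_1,\dots,f_k\}$ satisfies the Frobenius condition on $\Omega$, and that $\hat{\mathcal S}_h=\{\hat f_1,\dots,\hat f_h\}$ satisfies the Frobenius condition on $\Omega^*$ for every $h\le k$. Then for all $i\le k$ and $j\le M$ with $i\ne j$, the features $\hat f_i$ and $\hat f_j$ are decoupled on all of $\Omega^*$. In particular, the Frobenius condition being vacuous for a single feature, $\hat f_1$ and $\hat f_j$ are decoupled on $\Omega^*$ for $j=2,\dots,M$ without any Frobenius hypothesis. -/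

import Mathlib

/-- The signal space `ℝ^N` with its Euclidean structure. -/
abbrev Signal (N : ℕ) : Type := EuclideanSpace ℝ (Fin N)

/-- Two features are decoupled on `U`: at every point of `U` both are differentiable and their
gradients are orthogonal. -/
def DecoupledOn {N : ℕ} (p q : Signal N → ℝ) (U : Set (Signal N)) : Prop :=
  ∀ x ∈ U, DifferentiableAt ℝ p x ∧ DifferentiableAt ℝ q x ∧
    inner ℝ (gradient p x) (gradient q x) = 0

/-- The Frobenius condition on `U` for the gradients of the features `F j`, `j ∈ I`: the commutator
`XY - YX` of the gradient fields of any two of them lies pointwise in the span of the gradients. -/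
def FrobeniusOn {N M : ℕ} (F : Fin M → Signal N → ℝ) (I : Set (Fin M)) (U : Set (Signal N)) :
    Prop :=
  ∀ x ∈ U, ∀ a ∈ I, ∀ b ∈ I,
    VectorField.lieBracket ℝ (gradient (F a)) (gradient (F b)) x ∈
      Submodule.span ℝ ((fun c => gradient (F c) x) '' I)

/-- The tangent space at `x` of the reference manifold of the features with index `< m`, i.e. the
orthogonal complement of the span of their gradients. -/
noncomputable def refTangent {N M : ℕ} (f : Fin M → Signal N → ℝ) (m : Fin M) (x : Signal N) :
    Submodule ℝ (Signal N) :=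
  (Submodule.span ℝ ((fun c => gradient (f c) x) '' {c | c < m}))ᗮ

/-- The orthogonal projection of the gradient of `f m` on the tangent space of the reference
manifold of the preceding features. -/
noncomputable def projGradient {N M : ℕ} (f : Fin M → Signal N → ℝ) (m : Fin M) (x : Signal N) :
    Signal N :=
  (refTangent f m x).starProjection (gradient (f m) x)

/-- Starting at `y` and following the field `projGradient f m` inside `Ω` until `f m` takes its
reference value `v m` ends at `z`. The time `T` may have either sign: the curve is followed upwards
or downwards, according to the sign of `v m - f m y`. -/
def FollowsUntil {N M : ℕ} (Ω : Set (Signal N)) (f : Fin M → Signal N → ℝ) (v : Fin M → ℝ)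
    (m : Fin M) (y z : Signal N) : Prop :=
  ∃ (γ : ℝ → Signal N) (T : ℝ), γ 0 = y ∧ γ T = z ∧ f m z = v m ∧
    ∀ t ∈ Set.uIcc 0 T, γ t ∈ Ω ∧
      HasDerivWithinAt γ (projGradient f m (γ t)) (Set.uIcc 0 T) t

/-- The narrow path algorithm, started at `x`, completes its first `m` steps and is then at the
given point; the step with number `m + 1` adjusts the feature with (zero-based) index `m`. -/
def NarrowPath {N M : ℕ} (Ω : Set (Signal N)) (f : Fin M → Signal N → ℝ) (v : Fin M → ℝ) :
    ℕ → Signal N → Signal N → Prop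
  | 0, x, y => x ∈ Ω ∧ y = x
  | m + 1, x, z => ∃ hm : m < M, ∃ y, NarrowPath Ω f v m x y ∧ FollowsUntil Ω f v ⟨m, hm⟩ y z

open Classical in
/-- The normalization map computed by the first `m` steps of the narrow path algorithm (with the
irrelevant value `x` at those `x` from which the steps cannot be carried out). -/
noncomputable def narrowMap {N M : ℕ} (Ω : Set (Signal N)) (f : Fin M → Signal N → ℝ)
    (v : Fin M → ℝ) (m : ℕ) (x : Signal N) : Signal N :=
  if h : ∃ y, NarrowPath Ω f v m x y then h.choose else x

/-- The output features of the narrow path algorithm: with zero-based indices, the feature `j` is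
evaluated after the `j` features before it have been normalized. -/
noncomputable def hatFeature {N M : ℕ} (Ω : Set (Signal N)) (f : Fin M → Signal N → ℝ)
    (v : Fin M → ℝ) (j : Fin M) (x : Signal N) : ℝ :=
  f j (narrowMap Ω f v j x)

/-- The points of `Ω` from which the narrow path algorithm runs to completion, so that all the
output features are defined there. -/
def narrowDomain {N M : ℕ} (Ω : Set (Signal N)) (f : Fin M → Signal N → ℝ) (v : Fin M → ℝ) :
    Set (Signal N) :=
  {x | x ∈ Ω ∧ ∀ j : Fin M, ∃ y, NarrowPath Ω f v j x y}

open Set Filter Topology Metric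
open scoped NNReal

/-! ### Existence, uniqueness and Grönwall bounds for integral curves on `[0, 1]`. -/

section ODE

variable {E : Type*} [NormedAddCommGroup E] [NormedSpace ℝ E]

/-! Indices start at zero. Let R_a be the set of points of Ω where f_b = v_b for all b < a.

On R_a the gradient of f̂_a is g_a (`gradient_hatFeature_eq_projGradient`). There f̂_a = f_a, since
the first a steps do nothing, so by Lagrange multipliers ∇f_a - ∇f̂_a lies in the span of the ∇f_b,
b < a. Moreover f̂_a is constant along each earlier step, so ∇f̂_a is orthogonal to the g_b, b < a,
which have the same span. Hence ∇f̂_a is the projection defining g_a. For j > i the same constancy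
of f̂_j along step i gives ∇f̂_i ⊥ ∇f̂_j on R_i.

Orthogonality is carried from R_i back to any starting point along the steps a = i-1, ..., 0, by
strong induction on i. Step a stays in R_a, so it is an integral curve of φ = f̂_a's gradient field,
and by induction ∇φ is orthogonal to ∇χ and ∇ψ, where χ = f̂_i and ψ = f̂_j. Differentiating these
relations gives Hess χ ∇φ = -Hess φ ∇χ, and likewise for ψ; so the bracket of ∇φ and ∇χ is -2 Hess φ
∇χ, and q = ⟨∇χ, ∇ψ⟩ has derivative -2⟨Hess φ ∇χ, ∇ψ⟩ along ∇φ. By the Frobenius condition the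
bracket lies in the span of the ∇f̂_c, c ≤ i, of which only ∇χ can fail to be orthogonal to ∇ψ. So
|q'| ≤ C|q|, and q vanishes along the whole curve once it vanishes at one end
(`inner_gradient_eq_zero_of_integralCurve`).

The argument needs f̂_j of class C². The analytic part provides this: flows of C² fields are C² in
the starting point, and after rescaling the field so that f_m grows at unit rate the stopping time
is explicit. -/

theorem HasDerivWithinAt.Ici_of_Icc {γ : ℝ → E} {γ' : E} {a b t : ℝ}
    (h : HasDerivWithinAt γ γ' (Icc a b) t) (ht : t ∈ Ico a b) :
    HasDerivWithinAt γ γ' (Ici t) t :=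
  h.mono_of_mem_nhdsWithin (Icc_mem_nhdsGE_of_mem ht)

/-- Two integral curves on `[0, 1]` of a Lipschitz field stay exponentially close. -/
theorem LipschitzWith.dist_integralCurve_le {G : E → E} {K : ℝ≥0} (hG : LipschitzWith K G)
    {α β : ℝ → E} (hα : IsIntegralCurveOn α (fun _ => G) (Icc 0 1))
    (hβ : IsIntegralCurveOn β (fun _ => G) (Icc 0 1)) {t : ℝ} (ht : t ∈ Icc (0 : ℝ) 1) :
    dist (α t) (β t) ≤ dist (α 0) (β 0) * Real.exp K := by
  have h := dist_le_of_trajectories_ODE (v := fun _ => G) (fun _ => hG) hα.continuousOn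
    (fun s hs => (hα s (Ico_subset_Icc_self hs)).Ici_of_Icc hs) hβ.continuousOn
    (fun s hs => (hβ s (Ico_subset_Icc_self hs)).Ici_of_Icc hs) le_rfl t ht
  refine h.trans ?_
  gcongr
  have := mul_le_mul_of_nonneg_left ht.2 K.coe_nonneg
  simpa using this

/-- A smooth function on a neighbourhood of a compact set agrees near the compact set with a
smooth function of compact support on the whole space. -/
theorem ContDiffOn.exists_hasCompactSupport_eqOn [FiniteDimensional ℝ E] {F : Type*}
    [NormedAddCommGroup F] [NormedSpace ℝ F] {n : ℕ∞} {G : E → F} {U K : Set E}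
    (hG : ContDiffOn ℝ n G U) (hU : IsOpen U) (hK : IsCompact K) (hKU : K ⊆ U) :
    ∃ G' : E → F, ContDiff ℝ n G' ∧ HasCompactSupport G' ∧ (∀ x, ‖G' x‖ ≤ ‖G x‖) ∧
      ∃ W, IsOpen W ∧ K ⊆ W ∧ W ⊆ U ∧ EqOn G' G W := by
  obtain ⟨L, hL, hKL, hLU⟩ := exists_compact_between hK hU hKU
  obtain ⟨χ, hχ1, hχ0, hχ⟩ := exists_contMDiffMap_one_nhds_of_subset_interior
    (modelWithCornersSelf ℝ E) (n := n) hK.isClosed hKL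
  have hχs : ContDiff ℝ n χ := χ.contMDiff.contDiff
  refine ⟨fun x => χ x • G x, ?_, ?_, ?_, ?_⟩
  · refine contDiff_iff_contDiffAt.2 fun x => ?_
    by_cases hx : x ∈ U
    · exact hχs.contDiffAt.smul (hG.contDiffAt (hU.mem_nhds hx))
    · refine (contDiffAt_const (c := (0 : F))).congr_of_eventuallyEq ?_
      filter_upwards [hL.isClosed.isOpen_compl.mem_nhds fun h => hx (hLU h)] with y hy
      rw [hχ0 y hy, zero_smul]
  · exact HasCompactSupport.intro hL fun x hx => by rw [hχ0 x hx, zero_smul]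
  · intro x
    rw [norm_smul, Real.norm_of_nonneg (hχ x).1]
    exact mul_le_of_le_one_left (norm_nonneg _) (hχ x).2
  · obtain ⟨W, hW, hKW, hWχ⟩ := eventually_nhdsSet_iff_exists.1 hχ1
    exact ⟨W ∩ U, hW.inter hU, subset_inter hKW hKU, inter_subset_right,
      fun x hx => by simp [hWχ x hx.1]⟩

/-- Solutions of a linear differential inequality `‖y'‖ ≤ K ‖y‖ + ε` on `[0, 1]`. -/
theorem norm_le_of_norm_deriv_le {y y' : ℝ → E} {δ K ε : ℝ} (hK : 0 < K) (hε : 0 ≤ ε) (hδ : 0 ≤ δ)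
    (hy : ∀ t ∈ Icc (0 : ℝ) 1, HasDerivWithinAt y (y' t) (Icc 0 1) t) (h0 : ‖y 0‖ ≤ δ)
    (hle : ∀ t ∈ Icc (0 : ℝ) 1, ‖y' t‖ ≤ K * ‖y t‖ + ε) {t : ℝ} (ht : t ∈ Icc (0 : ℝ) 1) :
    ‖y t‖ ≤ δ * Real.exp K + ε / K * Real.exp K := by
  have h := norm_le_gronwallBound_of_norm_deriv_right_le
    (fun s hs => (hy s hs).continuousWithinAt)
    (fun s hs => (hy s (Ico_subset_Icc_self hs)).Ici_of_Icc hs) h0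
    (fun s hs => hle s (Ico_subset_Icc_self hs)) t ht
  rw [gronwallBound_of_K_ne_0 hK.ne', sub_zero] at h
  have he : Real.exp (K * t) ≤ Real.exp K := Real.exp_le_exp.2 (by nlinarith [ht.2])
  have hd : 0 ≤ ε / K := by positivity
  nlinarith

theorem exists_integralCurve_of_lipschitz [CompleteSpace E] {f : ℝ → E → E} {K L : ℝ≥0}
    (hf : ∀ t ∈ Icc (0 : ℝ) 1, LipschitzWith K (f t))
    (hc : ∀ x, ContinuousOn (fun t => f t x) (Icc 0 1))
    (hL : ∀ t ∈ Icc (0 : ℝ) 1, ∀ x, ‖f t x‖ ≤ L) (x : E) :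
    ∃ α : ℝ → E, α 0 = x ∧ IsIntegralCurveOn α f (Icc 0 1) := by
  have hpl : IsPicardLindelof f (tmin := 0) (tmax := 1) ⟨0, by simp⟩ x L 0 L K :=
    { lipschitzOnWith := fun t ht => (hf t ht).lipschitzOnWith
      continuousOn := fun x _ => hc x
      norm_le := fun t ht x _ => hL t ht x
      mul_max_le := by simp }
  exact hpl.exists_eq_forall_mem_Icc_hasDerivWithinAt₀

/-- Linear equations have solutions on the whole interval. -/
theorem exists_integralCurve_linear [FiniteDimensional ℝ E] {A : ℝ → E →L[ℝ] E} {K : ℝ}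
    (hA : ContinuousOn A (Icc 0 1)) (hK : ∀ t ∈ Icc (0 : ℝ) 1, ‖A t‖ ≤ K) (y₀ : E) :
    ∃ y : ℝ → E, y 0 = y₀ ∧ IsIntegralCurveOn y (fun t => A t) (Icc 0 1) := by
  have := FiniteDimensional.complete ℝ E
  have hK1 : 0 < |K| + 1 := by positivity
  have hAK : ∀ t ∈ Icc (0 : ℝ) 1, ‖A t‖ ≤ |K| + 1 := fun t ht =>
    (hK t ht).trans ((le_abs_self K).trans (by simp))
  -- `P` truncates the identity outside the ball that Grönwall's inequality confines the solution
  -- to. The truncated equation is bounded and Lipschitz, and since `‖P x‖ ≤ ‖x‖` its solution obeys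
  -- the same bound and never meets the truncation.
  obtain ⟨P, hP, hPc, hPn, W, -, hW, -, hPW⟩ :=
    (contDiffOn_id (𝕜 := ℝ) (n := (1 : ℕ∞)) (s := (univ : Set E))).exists_hasCompactSupport_eqOn
      isOpen_univ (isCompact_closedBall (0 : E) (‖y₀‖ * Real.exp (|K| + 1))) (subset_univ _)
  obtain ⟨C, hC⟩ := hP.lipschitzWith_of_hasCompactSupport hPc (by simp)
  obtain ⟨B, hB⟩ := hPc.exists_bound_of_continuous hP.continuous
  obtain ⟨y, hy0, hy⟩ := exists_integralCurve_of_lipschitz (f := fun t x => A t (P x))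
    (K := (|K| + 1).toNNReal * C) (L := ((|K| + 1) * |B|).toNNReal)
    (fun t ht => by
      refine LipschitzWith.comp ?_ hC
      refine (A t).lipschitz.weaken ?_
      rw [← NNReal.coe_le_coe, Real.coe_toNNReal _ hK1.le]
      exact hAK t ht)
    (fun x => hA.clm_apply continuousOn_const)
    (fun t ht x => by
      rw [Real.coe_toNNReal _ (by positivity)]
      refine ((A t).le_opNorm _).trans ?_
      gcongr
      · exact hAK t ht
      · exact (hB x).trans (le_abs_self B)) y₀
  have hbd : ∀ t ∈ Icc (0 : ℝ) 1, ‖y t‖ ≤ ‖y₀‖ * Real.exp (|K| + 1) := by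
    intro t ht
    have := norm_le_of_norm_deriv_le (δ := ‖y₀‖) (ε := 0) hK1 le_rfl (norm_nonneg _) hy
      (by rw [hy0]) (fun s hs => by
        rw [add_zero]
        refine ((A s).le_opNorm _).trans ?_
        gcongr
        · exact hAK s hs
        · exact hPn _) ht
    simpa using this
  refine ⟨y, hy0, fun t ht => ?_⟩
  have h : HasDerivWithinAt y (A t (P (y t))) (Icc 0 1) t := hy t ht
  rwa [hPW (hW (mem_closedBall_zero_iff.2 (hbd t ht)))] at h

/-- Two integral curves in an open set on which the field is smooth coincide if they start at the
same point. -/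
theorem IsIntegralCurveOn.eqOn_of_contDiffOn [FiniteDimensional ℝ E] {G : E → E} {U : Set E}
    (hG : ContDiffOn ℝ 1 G U) (hU : IsOpen U) {α β : ℝ → E}
    (hα : IsIntegralCurveOn α (fun _ => G) (Icc 0 1))
    (hβ : IsIntegralCurveOn β (fun _ => G) (Icc 0 1))
    (hαU : MapsTo α (Icc 0 1) U) (hβU : MapsTo β (Icc 0 1) U) (h0 : α 0 = β 0) :
    EqOn α β (Icc 0 1) := by
  obtain ⟨G', hG', hc, -, W, -, hKW, -, hW⟩ :=
    ContDiffOn.exists_hasCompactSupport_eqOn (n := 1) hG hU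
      ((isCompact_Icc.image_of_continuousOn hα.continuousOn).union
        (isCompact_Icc.image_of_continuousOn hβ.continuousOn))
      (union_subset hαU.image_subset hβU.image_subset)
  obtain ⟨K, hK⟩ := hG'.lipschitzWith_of_hasCompactSupport hc (by simp)
  have hα' : IsIntegralCurveOn α (fun _ => G') (Icc 0 1) := fun t ht => by
    simpa only [hW (hKW (Or.inl (mem_image_of_mem α ht)))] using hα t ht
  have hβ' : IsIntegralCurveOn β (fun _ => G') (Icc 0 1) := fun t ht => by
    simpa only [hW (hKW (Or.inr (mem_image_of_mem β ht)))] using hβ t ht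
  intro t ht
  have := hK.dist_integralCurve_le hα' hβ' ht
  rw [h0, dist_self, zero_mul] at this
  exact dist_le_zero.1 this

end ODE

/-! ### Differentiability of the flow in the starting point. -/

section Flow

variable {E : Type*} [NormedAddCommGroup E] [NormedSpace ℝ E]

theorem HasCompactSupport.uniformContinuous_fderiv {G : E → E} (hc : HasCompactSupport G)
    (hG : ContDiff ℝ 1 G) : UniformContinuous (fderiv ℝ G) :=
  (hG.continuous_fderiv one_ne_zero).uniformContinuous_of_tendsto_cocompact
    (hc.fderiv ℝ).is_zero_at_infty

/-- A globally Lipschitz smooth field has solutions of the flow equation and of its linearization,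
and the time-one map is continuously differentiable with derivative the linearized flow. -/
theorem exists_flow_and_linearization [FiniteDimensional ℝ E] {G : E → E} (hG : ContDiff ℝ 1 G)
    (hc : HasCompactSupport G) :
    ∃ (Φ : E → ℝ → E) (J : E → ℝ → E →L[ℝ] E),
      (∀ x, Φ x 0 = x ∧ IsIntegralCurveOn (Φ x) (fun _ => G) (Icc 0 1)) ∧
      (∀ x, J x 0 = ContinuousLinearMap.id ℝ E ∧ ∀ t ∈ Icc (0 : ℝ) 1,
        HasDerivWithinAt (J x) ((fderiv ℝ G (Φ x t)).comp (J x t)) (Icc 0 1) t) ∧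
      (∀ x, HasFDerivAt (fun x => Φ x 1) (J x 1) x) ∧ Continuous fun x => J x 1 := by
  have := FiniteDimensional.complete ℝ E
  obtain ⟨K₀, hK₀⟩ := hG.lipschitzWith_of_hasCompactSupport hc one_ne_zero
  -- A positive constant, because the Grönwall bound divides by it.
  set K : ℝ≥0 := K₀ + 1
  have hK : LipschitzWith K G := hK₀.weaken (by simp [K])
  have hKpos : (0 : ℝ) < K := by positivity
  have hDK (x : E) : ‖fderiv ℝ G x‖ ≤ K := norm_fderiv_le_of_lipschitz ℝ hK
  have hDu := hc.uniformContinuous_fderiv hG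
  obtain ⟨B, hB⟩ := hc.exists_bound_of_continuous hG.continuous
  have hflow (x : E) : ∃ α : ℝ → E, α 0 = x ∧ IsIntegralCurveOn α (fun _ => G) (Icc 0 1) :=
    exists_integralCurve_of_lipschitz (L := |B|.toNNReal) (fun _ _ => hK)
      (fun _ => continuousOn_const)
      (fun t _ y => by
        rw [Real.coe_toNNReal _ (abs_nonneg B)]
        exact (hB y).trans (le_abs_self B)) x
  choose Φ hΦ0 hΦ using hflow
  have hlin (x : E) : ∃ J : ℝ → E →L[ℝ] E, J 0 = ContinuousLinearMap.id ℝ E ∧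
      IsIntegralCurveOn J
        (fun t => ContinuousLinearMap.compL ℝ E E E (fderiv ℝ G (Φ x t))) (Icc 0 1) := by
    refine exists_integralCurve_linear (K := K) ?_ ?_ _
    · exact (ContinuousLinearMap.continuous _).comp_continuousOn
        ((hG.continuous_fderiv one_ne_zero).comp_continuousOn (hΦ x).continuousOn)
    · intro t _
      refine ContinuousLinearMap.opNorm_le_bound _ hKpos.le fun A => ?_
      exact (ContinuousLinearMap.opNorm_comp_le _ _).trans (by gcongr; exact hDK _)
  choose J hJ0 hJ using hlin
  have hJ' (x : E) (t : ℝ) (ht : t ∈ Icc (0 : ℝ) 1) :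
      HasDerivWithinAt (J x) ((fderiv ℝ G (Φ x t)).comp (J x t)) (Icc 0 1) t := hJ x t ht
  set M := Real.exp K
  have hM : 0 < M := Real.exp_pos _
  have hΦdist (x y : E) (t : ℝ) (ht : t ∈ Icc (0 : ℝ) 1) : ‖Φ x t - Φ y t‖ ≤ ‖x - y‖ * M := by
    have := hK.dist_integralCurve_le (hΦ x) (hΦ y) ht
    rwa [hΦ0, hΦ0, dist_eq_norm, dist_eq_norm] at this
  have hJM (x : E) (t : ℝ) (ht : t ∈ Icc (0 : ℝ) 1) : ‖J x t‖ ≤ M := by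
    have := norm_le_of_norm_deriv_le (δ := 1) (ε := 0) hKpos le_rfl zero_le_one (hJ' x)
      (by rw [hJ0]; exact ContinuousLinearMap.norm_id_le)
      (fun s _ => by
        rw [add_zero]
        exact (ContinuousLinearMap.opNorm_comp_le _ _).trans (by gcongr; exact hDK _)) ht
    simpa using this
  have hnear (x : E) (ε : ℝ) (hε : 0 < ε) : ∀ᶠ y in 𝓝 x, ∀ t ∈ Icc (0 : ℝ) 1,
      ‖fderiv ℝ G (Φ y t) - fderiv ℝ G (Φ x t)‖ ≤ ε ∧
      ‖G (Φ y t) - G (Φ x t) - fderiv ℝ G (Φ x t) (Φ y t - Φ x t)‖ ≤ ε * ‖Φ y t - Φ x t‖ := by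
    obtain ⟨ρ, hρ, h⟩ := Metric.uniformContinuous_iff.1 hDu ε hε
    filter_upwards [ball_mem_nhds x (div_pos hρ hM)] with y hy t ht
    have hd : Φ y t ∈ ball (Φ x t) ρ := by
      rw [mem_ball, dist_eq_norm]
      refine (hΦdist y x t ht).trans_lt ?_
      rwa [mem_ball, dist_eq_norm, lt_div_iff₀ hM] at hy
    have hb : ∀ z ∈ ball (Φ x t) ρ, ‖fderiv ℝ G z - fderiv ℝ G (Φ x t)‖ ≤ ε := fun z hz => by
      rw [← dist_eq_norm]
      exact (h hz).le
    exact ⟨hb _ hd, (convex_ball _ _).norm_image_sub_le_of_norm_fderiv_le'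
      (fun z _ => hG.differentiable one_ne_zero z) hb (mem_ball_self hρ) hd⟩
  refine ⟨Φ, J, fun x => ⟨hΦ0 x, hΦ x⟩, fun x => ⟨hJ0 x, hJ' x⟩, fun x => ?_, ?_⟩
  · refine HasFDerivAt.of_isLittleO (Asymptotics.isLittleO_iff.2 fun c hcpos => ?_)
    -- The linearization error grows under a forcing of size at most `ε * (‖y - x‖ * M)`, which
    -- Grönwall turns into `ε * ‖y - x‖ * M * M / K`; this `ε` makes the result `c * ‖y - x‖`.
    filter_upwards [hnear x (c * K / (M * M)) (by positivity)] with y hy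
    have := norm_le_of_norm_deriv_le (y := fun t => Φ y t - Φ x t - J x t (y - x))
      (δ := 0) (K := K) (ε := c * K / (M * M) * (‖y - x‖ * M)) hKpos (by positivity) le_rfl
      (fun t ht => ((hΦ y t ht).sub (hΦ x t ht)).sub
        ((hJ' x t ht).clm_apply (hasDerivWithinAt_const t _ (y - x))))
      (by simp [hΦ0, hJ0])
      (fun t ht => by
        have e : G (Φ y t) - G (Φ x t) -
            (((fderiv ℝ G (Φ x t)).comp (J x t)) (y - x) + J x t 0) =
            fderiv ℝ G (Φ x t) (Φ y t - Φ x t - J x t (y - x)) +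
            (G (Φ y t) - G (Φ x t) - fderiv ℝ G (Φ x t) (Φ y t - Φ x t)) := by
          simp only [ContinuousLinearMap.comp_apply, map_sub, map_zero]
          abel
        rw [e]
        refine (norm_add_le _ _).trans (add_le_add ?_ ?_)
        · exact (ContinuousLinearMap.le_opNorm _ _).trans (by gcongr; exact hDK _)
        · refine ((hy t ht).2).trans ?_
          gcongr
          exact hΦdist y x t ht) (t := 1) (by simp)
    refine this.trans (le_of_eq ?_)
    change 0 * M + _ * M = _
    field_simp
    ring
  · refine continuous_iff_continuousAt.2 fun x => Metric.tendsto_nhds.2 fun c hcpos => ?_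
    filter_upwards [hnear x (c / 2 * K / (M * M)) (by positivity)] with y hy
    have := norm_le_of_norm_deriv_le (y := fun t => J y t - J x t)
      (δ := 0) (K := K) (ε := c / 2 * K / (M * M) * M) hKpos (by positivity) le_rfl
      (fun t ht => (hJ' y t ht).sub (hJ' x t ht))
      (by simp [hJ0])
      (fun t ht => by
        have e : (fderiv ℝ G (Φ y t)).comp (J y t) - (fderiv ℝ G (Φ x t)).comp (J x t) =
            (fderiv ℝ G (Φ x t)).comp (J y t - J x t) +
            (fderiv ℝ G (Φ y t) - fderiv ℝ G (Φ x t)).comp (J y t) := by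
          ext v
          simp
        rw [e]
        refine (norm_add_le _ _).trans (add_le_add ?_ ?_)
        · exact (ContinuousLinearMap.opNorm_comp_le _ _).trans (by gcongr; exact hDK _)
        · refine (ContinuousLinearMap.opNorm_comp_le _ _).trans ?_
          gcongr
          · exact (hy t ht).1
          · exact hJM y t ht) (t := 1) (by simp)
    rw [dist_eq_norm]
    refine this.trans_lt ?_
    change 0 * M + _ * M < _
    rw [zero_mul, zero_add]
    field_simp
    norm_num

/-- Near an integral curve, the flow of a field may be computed from a field of compact support. -/
theorem IsIntegralCurveOn.exists_hasCompactSupport [FiniteDimensional ℝ E] {n : ℕ∞} (hn : n ≠ 0)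
    {G : E → E} {U : Set E} (hG : ContDiffOn ℝ n G U) (hU : IsOpen U) {α : ℝ → E}
    (hα : IsIntegralCurveOn α (fun _ => G) (Icc 0 1)) (hαU : MapsTo α (Icc 0 1) U) :
    ∃ G' : E → E, ContDiff ℝ n G' ∧ HasCompactSupport G' ∧ ∀ Φ : E → ℝ → E,
      (∀ x, Φ x 0 = x ∧ IsIntegralCurveOn (Φ x) (fun _ => G') (Icc 0 1)) →
      ∀ᶠ x in 𝓝 (α 0), IsIntegralCurveOn (Φ x) (fun _ => G) (Icc 0 1) ∧
        MapsTo (Φ x) (Icc 0 1) U := by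
  have hcpt := isCompact_Icc.image_of_continuousOn hα.continuousOn
  obtain ⟨G', hG', hc, -, W, hWo, hKW, hWU, hW⟩ :=
    hG.exists_hasCompactSupport_eqOn hU hcpt hαU.image_subset
  obtain ⟨K, hK⟩ := hG'.lipschitzWith_of_hasCompactSupport hc (by simpa using hn)
  have hα' : IsIntegralCurveOn α (fun _ => G') (Icc 0 1) := fun t ht => by
    simpa only [hW (hKW (mem_image_of_mem α ht))] using hα t ht
  obtain ⟨ε, hε, hεW⟩ := hcpt.exists_thickening_subset_open hWo hKW
  refine ⟨G', hG', hc, fun Φ hΦ => ?_⟩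
  -- Curves diverge by a factor of at most `exp K`, so these starting points keep them within `ε` of
  -- `α`, where the two fields agree.
  filter_upwards [ball_mem_nhds (α 0) (div_pos hε (Real.exp_pos K))] with x hx
  have hxW : MapsTo (Φ x) (Icc 0 1) W := fun t ht => by
    refine hεW (mem_thickening_iff.2 ⟨α t, mem_image_of_mem α ht, ?_⟩)
    refine (hK.dist_integralCurve_le (hΦ x).2 hα' ht).trans_lt ?_
    rwa [(hΦ x).1, ← lt_div_iff₀ (Real.exp_pos _)]
  exact ⟨fun t ht => by simpa only [hW (hxW ht)] using (hΦ x).2 t ht, hxW.mono_right hWU⟩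

/-- Continuously differentiable dependence of integral curves on their starting point. -/
theorem IsIntegralCurveOn.exists_contDiffAt_one [FiniteDimensional ℝ E]
    {G : E → E} {U : Set E} (hG : ContDiffOn ℝ 1 G U) (hU : IsOpen U) {α : ℝ → E}
    (hα : IsIntegralCurveOn α (fun _ => G) (Icc 0 1)) (hαU : MapsTo α (Icc 0 1) U) :
    ∃ Φ : E → ℝ → E, (∀ x, Φ x 0 = x) ∧ ContDiff ℝ 1 (fun x => Φ x 1) ∧
      ∀ᶠ x in 𝓝 (α 0), IsIntegralCurveOn (Φ x) (fun _ => G) (Icc 0 1) ∧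
        MapsTo (Φ x) (Icc 0 1) U := by
  obtain ⟨G', hG', hc, h⟩ := hα.exists_hasCompactSupport (n := 1) one_ne_zero hG hU hαU
  obtain ⟨Φ, J, hΦ, -, hd, hJ⟩ := exists_flow_and_linearization hG' hc
  exact ⟨Φ, fun x => (hΦ x).1, contDiff_one_iff_hasFDerivAt.2 ⟨_, hJ, hd⟩, h Φ hΦ⟩

/-- Twice continuously differentiable dependence of integral curves on their starting point. -/
theorem IsIntegralCurveOn.exists_contDiffAt_two [FiniteDimensional ℝ E]
    {G : E → E} {U : Set E} (hG : ContDiffOn ℝ 2 G U) (hU : IsOpen U) {α : ℝ → E}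
    (hα : IsIntegralCurveOn α (fun _ => G) (Icc 0 1)) (hαU : MapsTo α (Icc 0 1) U) :
    ∃ Φ : E → ℝ → E, (∀ x, Φ x 0 = x) ∧ ContDiff ℝ 2 (fun x => Φ x 1) ∧
      ∀ᶠ x in 𝓝 (α 0), IsIntegralCurveOn (Φ x) (fun _ => G) (Icc 0 1) ∧
        MapsTo (Φ x) (Icc 0 1) U := by
  obtain ⟨G', hG', hc, h⟩ := hα.exists_hasCompactSupport (n := 2) two_ne_zero hG hU hαU
  replace hG' : ContDiff ℝ 2 G' := hG'
  obtain ⟨Φ, J, hΦ, hJ, hd, -⟩ := exists_flow_and_linearization (hG'.of_le one_le_two) hc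
  refine ⟨Φ, fun x => (hΦ x).1, ?_, h Φ hΦ⟩
  refine (contDiff_succ_iff_hasFDerivAt (n := 1)).2 ⟨fun x => J x 1, ?_, hd⟩
  refine contDiff_iff_contDiffAt.2 fun x => ?_
  -- The flow together with its linearization is the flow of the `C¹` field `H`. The `C¹` theorem
  -- applied to `H` makes the derivative `J x 1` of the time-one map `C¹` in `x`.
  let H : E × (E →L[ℝ] E) → E × (E →L[ℝ] E) := fun p => (G' p.1, (fderiv ℝ G' p.1).comp p.2)
  have hH : ContDiffOn ℝ 1 H univ := by
    have h1 : ContDiff ℝ 1 (fderiv ℝ G') := hG'.fderiv_right (by norm_num)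
    exact ((hG'.of_le one_le_two).comp contDiff_fst).prodMk
      ((h1.comp contDiff_fst).clm_comp contDiff_snd) |>.contDiffOn
  have hcurve (y : E) : IsIntegralCurveOn (fun t => (Φ y t, J y t)) (fun _ => H) (Icc 0 1) :=
    fun t ht => ((hΦ y).2 t ht).prodMk ((hJ y).2 t ht)
  obtain ⟨Ψ, hΨ0, hΨ, hev⟩ :=
    (hcurve x).exists_contDiffAt_one hH isOpen_univ (mapsTo_univ _ _)
  have hι : ContDiff ℝ 1 (fun y : E => (y, ContinuousLinearMap.id ℝ E)) :=
    contDiff_id.prodMk contDiff_const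
  have hev' : ∀ᶠ y in 𝓝 x, IsIntegralCurveOn (Ψ (y, ContinuousLinearMap.id ℝ E))
      (fun _ => H) (Icc 0 1) := by
    have : Tendsto (fun y : E => (y, ContinuousLinearMap.id ℝ E)) (𝓝 x) (𝓝 (Φ x 0, J x 0)) := by
      rw [(hΦ x).1, (hJ x).1]
      exact hι.continuous.continuousAt
    exact (this.eventually hev).mono fun y hy => hy.1
  have hsnd : ContDiff ℝ 1 (fun y : E => (Ψ (y, ContinuousLinearMap.id ℝ E) 1).2) :=
    contDiff_snd.comp (hΨ.comp hι)
  refine hsnd.contDiffAt.congr_of_eventuallyEq ?_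
  filter_upwards [hev'] with y hy
  have := IsIntegralCurveOn.eqOn_of_contDiffOn hH isOpen_univ hy (hcurve y)
    (mapsTo_univ _ _) (mapsTo_univ _ _) (by simp [hΨ0, (hΦ y).1, (hJ y).1])
    (show (1 : ℝ) ∈ Icc (0 : ℝ) 1 by simp)
  rw [this]

end Flow

/-! ### Stopping at a level of a function that increases along the field. -/

section Hitting

variable {E : Type*} [NormedAddCommGroup E] [NormedSpace ℝ E]

/-- A curve whose velocity is a positive multiple of a field can be reparametrized to have velocity
a constant multiple of the field. -/
theorem exists_reparametrization {γ : ℝ → E} {X : E → E} {μ : ℝ → ℝ}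
    (hμ : ContinuousOn μ (Icc 0 1)) (hpos : ∀ t ∈ Icc (0 : ℝ) 1, 0 < μ t)
    (hγ : ∀ t ∈ Icc (0 : ℝ) 1, HasDerivWithinAt γ (μ t • X (γ t)) (Icc 0 1) t) :
    ∃ c : ℝ, ∃ σ : ℝ → ℝ, σ 0 = 0 ∧ σ 1 = 1 ∧ MapsTo σ (Icc 0 1) (Icc 0 1) ∧
      IsIntegralCurveOn (γ ∘ σ) (fun _ p => c • X p) (Icc 0 1) := by
  set l : ℝ → ℝ := IccExtend zero_le_one ((Icc (0 : ℝ) 1).domRestrict μ) with hl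
  have hlc : Continuous l := (continuousOn_iff_continuous_domRestrict.1 hμ).Icc_extend'
  have hlμ : ∀ t ∈ Icc (0 : ℝ) 1, l t = μ t := fun t ht => by
    rw [hl, IccExtend_of_mem _ _ ht, domRestrict_apply]
  obtain ⟨t₀, ht₀, hmin⟩ := isCompact_Icc.exists_isMinOn (nonempty_Icc.2 zero_le_one) hμ
  have hm : 0 < μ t₀ := hpos t₀ ht₀
  have hml (t : ℝ) : μ t₀ ≤ l t := hmin (projIcc 0 1 zero_le_one t).2
  -- The new clock. `l` extends `μ` by constants and is bounded below by a positive number, so `h`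
  -- is an increasing bijection of `ℝ`; `σ` is its inverse, rescaled to fix both `0` and `1`.
  set h : ℝ → ℝ := fun t => ∫ s in (0 : ℝ)..t, l s with hh
  have hd (t : ℝ) : HasDerivAt h (l t) t := hlc.integral_hasStrictDerivAt 0 t |>.hasDerivAt
  have hh0 : h 0 = 0 := by simp [hh]
  have hmono : StrictMono h := strictMono_of_deriv_pos fun t => by
    rw [(hd t).deriv]
    exact hm.trans_le (hml t)
  have hmono' : Monotone fun t => h t - μ t₀ * t := by
    have hd' (t : ℝ) : HasDerivAt (fun t => h t - μ t₀ * t) (l t - μ t₀) t :=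
      ((hd t).sub ((hasDerivAt_id t).const_mul (μ t₀))).congr_deriv (by simp)
    refine monotone_of_deriv_nonneg (fun t => (hd' t).differentiableAt) fun t => ?_
    rw [(hd' t).deriv]
    linarith [hml t]
  have hsurj : Function.Surjective h := by
    refine (continuous_iff_continuousAt.2 fun t => (hd t).continuousAt).surjective ?_ ?_
    · refine tendsto_atTop_mono' _ ?_ (tendsto_id.const_mul_atTop hm)
      filter_upwards [eventually_ge_atTop 0] with t ht
      have := hmono' ht
      simp only [hh0, mul_zero, sub_zero] at this
      simpa using this
    · refine tendsto_atBot_mono' _ ?_ (tendsto_id.const_mul_atBot hm)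
      filter_upwards [eventually_le_atBot 0] with t ht
      have := hmono' ht
      simp only [hh0, mul_zero, sub_zero] at this
      simpa using this
  set e := hmono.orderIsoOfSurjective h hsurj with he
  have heh (t : ℝ) : h (e.symm t) = t := e.apply_symm_apply t
  have hsymm (t : ℝ) : e.symm (h t) = t := e.symm_apply_apply t
  have hcpos : 0 < h 1 := hh0 ▸ hmono zero_lt_one
  have hσ0 : e.symm (h 1 * 0) = 0 := by
    rw [mul_zero]
    simpa only [hh0] using hsymm 0
  have hσ1 : e.symm (h 1 * 1) = 1 := by rw [mul_one, hsymm]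
  have hmaps : MapsTo (fun t => e.symm (h 1 * t)) (Icc 0 1) (Icc 0 1) := fun t ht =>
    ⟨by rw [← hσ0]; exact e.symm.monotone (by gcongr; exact ht.1),
      by conv_rhs => rw [← hσ1]
         exact e.symm.monotone (by gcongr; exact ht.2)⟩
  refine ⟨h 1, fun t => e.symm (h 1 * t), hσ0, hσ1, hmaps, fun t ht => ?_⟩
  have hne (s : ℝ) : l s ≠ 0 := (hm.trans_le (hml s)).ne'
  have hd1 : HasDerivAt e.symm (l (e.symm (h 1 * t)))⁻¹ (h 1 * t) :=
    HasDerivAt.of_local_left_inverse e.symm.continuous.continuousAt (hd _) (hne _)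
      (Eventually.of_forall heh)
  have hd2 : HasDerivAt (fun t => e.symm (h 1 * t)) ((l (e.symm (h 1 * t)))⁻¹ * (h 1 * 1)) t :=
    HasDerivAt.comp t hd1 ((hasDerivAt_id t).const_mul (h 1))
  have hd3 := HasDerivWithinAt.scomp t (hγ _ (hmaps ht)) hd2.hasDerivWithinAt hmaps
  convert hd3 using 1
  rw [smul_smul, ← hlμ _ (hmaps ht)]
  field_simp [hne]
  simp

/-- Following the field `g` from `y` inside `Ω`, forwards or backwards in time, leads to the point
`z` at which `F` has the value `w`. -/
def Reaches (Ω : Set E) (g : E → E) (F : E → ℝ) (w : ℝ) (y z : E) : Prop :=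
  ∃ (γ : ℝ → E) (T : ℝ), γ 0 = y ∧ γ T = z ∧ F z = w ∧
    ∀ t ∈ uIcc 0 T, γ t ∈ Ω ∧ HasDerivWithinAt γ (g (γ t)) (uIcc 0 T) t

/-- The multiple of `g` along which `F` grows at unit rate. -/
noncomputable def unitSpeed (g : E → E) (F : E → ℝ) (y : E) : E :=
  (fderiv ℝ F y (g y))⁻¹ • g y

variable {Ω : Set E} {g : E → E} {F : E → ℝ} {w : ℝ}

theorem mul_mem_uIcc_of_mem_Icc {T t : ℝ} (ht : t ∈ Icc (0 : ℝ) 1) : T * t ∈ uIcc 0 T := by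
  rw [mem_uIcc]
  rcases le_total 0 T with h | h
  · exact Or.inl ⟨mul_nonneg h ht.1, mul_le_of_le_one_right h ht.2⟩
  · exact Or.inr ⟨by nlinarith [ht.2], mul_nonpos_of_nonpos_of_nonneg h ht.1⟩

theorem HasDerivWithinAt.comp_mul_Icc {γ : ℝ → E} {γ' : E} {T t : ℝ}
    (h : HasDerivWithinAt γ γ' (uIcc 0 T) (T * t)) :
    HasDerivWithinAt (fun s => γ (T * s)) (T • γ') (Icc 0 1) t := by
  have h2 : HasDerivWithinAt (fun s : ℝ => T * s) (T * 1) (Icc 0 1) t :=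
    (hasDerivWithinAt_id t _).const_mul T
  have := HasDerivWithinAt.scomp t h h2 fun s hs => mul_mem_uIcc_of_mem_Icc hs
  rwa [mul_one] at this

theorem apply_eq_add_of_unitSpeed (hΩ : IsOpen Ω) (hF : DifferentiableOn ℝ F Ω)
    (hpos : ∀ y ∈ Ω, 0 < fderiv ℝ F y (g y)) {δ : ℝ → E} {s : ℝ} (hδΩ : MapsTo δ (Icc 0 1) Ω)
    (hδ : IsIntegralCurveOn δ (fun _ p => s • unitSpeed g F p) (Icc 0 1)) :
    F (δ 1) = F (δ 0) + s := by
  have hd : ∀ t ∈ Icc (0 : ℝ) 1,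
      HasDerivWithinAt (fun t => F (δ t) - t * s) 0 (Icc 0 1) t := fun t ht => by
    have h1 := (hF.differentiableAt (hΩ.mem_nhds (hδΩ ht))).hasFDerivAt.comp_hasDerivWithinAt t
      (hδ t ht)
    have h2 := h1.sub ((hasDerivWithinAt_id t (Icc (0 : ℝ) 1)).mul_const s)
    refine h2.congr_deriv ?_
    simp [unitSpeed, inv_mul_cancel₀ (hpos _ (hδΩ ht)).ne']
  have := constant_of_has_deriv_right_zero (fun t ht => (hd t ht).continuousWithinAt)
    (fun t ht => (hd t (Ico_subset_Icc_self ht)).Ici_of_Icc ht) 1 (by simp)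
  simp only [one_mul, zero_mul, sub_zero] at this
  linarith

/-- At unit growth rate of `F` the time needed is exactly `w - F y`. Putting this factor into the
field leaves a curve on `[0, 1]`, with no unknown stopping time and no distinction between forwards
and backwards. -/
theorem reaches_iff (hΩ : IsOpen Ω) (hg : ContinuousOn g Ω) (hF : ContDiffOn ℝ 1 F Ω)
    (hpos : ∀ y ∈ Ω, 0 < fderiv ℝ F y (g y)) {y z : E} :
    Reaches Ω g F w y z ↔ ∃ δ : ℝ → E, δ 0 = y ∧ δ 1 = z ∧ MapsTo δ (Icc 0 1) Ω ∧
      IsIntegralCurveOn δ (fun _ p => (w - F y) • unitSpeed g F p) (Icc 0 1) := by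
  have hρ : ContinuousOn (fun y => fderiv ℝ F y (g y)) Ω :=
    (hF.continuousOn_fderiv_of_isOpen hΩ le_rfl).clm_apply hg
  have hFd : DifferentiableOn ℝ F Ω := hF.differentiableOn one_ne_zero
  constructor
  · rintro ⟨γ, T, h0, hT, hw, hγ⟩
    have hγd : ∀ t ∈ Icc (0 : ℝ) 1, HasDerivWithinAt (fun s => γ (T * s))
        (T • g (γ (T * t))) (Icc 0 1) t := fun t ht =>
      (hγ _ (mul_mem_uIcc_of_mem_Icc ht)).2.comp_mul_Icc
    have hmaps : MapsTo (fun s => γ (T * s)) (Icc 0 1) Ω := fun t ht =>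
      (hγ _ (mul_mem_uIcc_of_mem_Icc ht)).1
    obtain ⟨c, σ, hσ0, hσ1, hσ, hδ⟩ := exists_reparametrization
      (γ := fun s => γ (T * s)) (X := fun p => T • unitSpeed g F p)
      (μ := fun t => fderiv ℝ F (γ (T * t)) (g (γ (T * t))))
      (hρ.comp (fun t ht => (hγd t ht).continuousWithinAt) hmaps)
      (fun t ht => hpos _ (hmaps ht)) (fun t ht => by
        refine (hγd t ht).congr_deriv ?_
        have := (hpos _ (hmaps ht)).ne'
        dsimp only [unitSpeed] at this ⊢
        rw [smul_comm, smul_smul (fderiv ℝ F _ _), mul_inv_cancel₀ this, one_smul])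
    simp only [smul_smul] at hδ
    have := apply_eq_add_of_unitSpeed hΩ hFd hpos (hmaps.comp hσ) hδ
    simp only [Function.comp_apply, hσ0, hσ1, mul_one, mul_zero, h0, hT, hw] at this
    have hc : c * T = w - F y := by linarith
    rw [hc] at hδ
    exact ⟨_, by simp [hσ0, h0], by simp [hσ1, hT], hmaps.comp hσ, hδ⟩
  · rintro ⟨δ, h0, h1, hmaps, hδ⟩
    have hz := apply_eq_add_of_unitSpeed hΩ hFd hpos hmaps hδ
    rw [h0, h1, add_sub_cancel] at hz
    obtain ⟨c, σ, hσ0, hσ1, hσ, hγ⟩ := exists_reparametrization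
      (γ := δ) (X := fun p => (w - F y) • g p)
      (μ := fun t => (fderiv ℝ F (δ t) (g (δ t)))⁻¹)
      ((hρ.comp hδ.continuousOn hmaps).inv₀ fun t ht => (hpos _ (hmaps ht)).ne')
      (fun t ht => inv_pos.2 (hpos _ (hmaps ht))) (fun t ht => by
        convert hδ t ht using 1
        dsimp only [unitSpeed]
        rw [smul_comm])
    simp only [smul_smul] at hγ
    set T := c * (w - F y)
    have hmaps' := hmaps.comp hσ
    -- For `T = 0` the curve does not move, and rescaling time by `T⁻¹` is not available.
    rcases eq_or_ne T 0 with hT | hT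
    · have hconst := constant_of_has_deriv_right_zero hγ.continuousOn (fun t ht => by
        have := hγ t (Ico_subset_Icc_self ht)
        simp only [hT, zero_smul] at this
        exact this.Ici_of_Icc ht) 1 (by simp)
      simp only [Function.comp_apply, hσ0, hσ1, h0, h1] at hconst
      subst hconst
      refine ⟨fun _ => z, 0, rfl, rfl, hz, fun t ht => ?_⟩
      rw [uIcc_self, mem_singleton_iff] at ht
      subst ht
      refine ⟨by rw [← h0]; exact hmaps (by simp), ?_⟩
      rw [uIcc_self]
      simp [hasDerivWithinAt_iff_hasFDerivWithinAt, HasFDerivWithinAt.of_subsingleton]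
    · refine ⟨fun t => δ (σ (T⁻¹ * t)), T, by simp [hσ0, h0], by simp [hT, hσ1, h1], hz, ?_⟩
      have hm : MapsTo (fun t => T⁻¹ * t) (uIcc 0 T) (Icc 0 1) := fun t ht => by
        rw [mem_uIcc] at ht
        change T⁻¹ * t ∈ _
        rw [← div_eq_inv_mul]
        rcases ht with ⟨h, h'⟩ | ⟨h, h'⟩
        · exact ⟨div_nonneg h (h.trans h'), div_le_one_of_le₀ h' (h.trans h')⟩
        · exact ⟨div_nonneg_of_nonpos h' (h.trans h'), div_le_one_of_ge h (h.trans h')⟩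
      intro t ht
      refine ⟨hmaps' (hm ht), ?_⟩
      have := HasDerivWithinAt.scomp t (hγ _ (hm ht))
        ((hasDerivWithinAt_id t (uIcc 0 T)).const_mul T⁻¹) hm
      refine this.congr_deriv ?_
      simp [smul_smul, hT]

theorem Reaches.unique [FiniteDimensional ℝ E] (hΩ : IsOpen Ω) (hg : ContDiffOn ℝ 1 g Ω)
    (hF : ContDiffOn ℝ 2 F Ω) (hpos : ∀ y ∈ Ω, 0 < fderiv ℝ F y (g y)) {y z z' : E}
    (h : Reaches Ω g F w y z) (h' : Reaches Ω g F w y z') : z = z' := by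
  have hF1 : ContDiffOn ℝ 1 F Ω := hF.of_le one_le_two
  obtain ⟨α, hα0, rfl, hαΩ, hα⟩ := (reaches_iff hΩ hg.continuousOn hF1 hpos).1 h
  obtain ⟨β, hβ0, rfl, hβΩ, hβ⟩ := (reaches_iff hΩ hg.continuousOn hF1 hpos).1 h'
  have hu : ContDiffOn ℝ 1 (fun p => (w - F y) • unitSpeed g F p) Ω :=
    contDiffOn_const.smul ((((hF.fderiv_of_isOpen hΩ (by norm_num)).clm_apply hg).inv
      fun p hp => (hpos p hp).ne').smul hg)
  exact IsIntegralCurveOn.eqOn_of_contDiffOn hu hΩ hα hβ hαΩ hβΩ (hα0.trans hβ0.symm) (by simp)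

/-- The point reached depends in a `C²` way on the starting point. -/
theorem Reaches.exists_contDiffAt [FiniteDimensional ℝ E] (hΩ : IsOpen Ω)
    (hg : ContDiffOn ℝ 2 g Ω) (hF : ContDiffOn ℝ 3 F Ω)
    (hpos : ∀ y ∈ Ω, 0 < fderiv ℝ F y (g y)) {y z : E} (h : Reaches Ω g F w y z) :
    ∃ P : E → E, ContDiffAt ℝ 2 P y ∧ P y = z ∧ ∀ᶠ y' in 𝓝 y, Reaches Ω g F w y' (P y') := by
  have hF1 : ContDiffOn ℝ 1 F Ω := hF.of_le (by norm_num)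
  have hF2 : ContDiffOn ℝ 2 F Ω := hF.of_le (by norm_num)
  have hr {y z : E} := reaches_iff (w := w) (y := y) (z := z) hΩ hg.continuousOn hF1 hpos
  obtain ⟨δ, h0, h1, hδΩ, hδ⟩ := hr.1 h
  have hyΩ : y ∈ Ω := h0 ▸ hδΩ (by simp)
  have hu : ContDiffOn ℝ 2 (unitSpeed g F) Ω :=
    ((((hF.fderiv_of_isOpen hΩ (by norm_num)).clm_apply hg).inv
      fun p hp => (hpos p hp).ne').smul hg)
  -- The factor `w - F y` varies with the starting point. As a second coordinate that stays constant
  -- along the motion, it becomes part of the initial value, and smooth dependence on initial values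
  -- covers it.
  let H : E × ℝ → E × ℝ := fun p => (p.2 • unitSpeed g F p.1, 0)
  have hH : ContDiffOn ℝ 2 H (Ω ×ˢ univ) :=
    (contDiffOn_snd.smul (hu.comp contDiffOn_fst fun p hp => hp.1)).prodMk contDiffOn_const
  have hα : IsIntegralCurveOn (fun t => (δ t, w - F y)) (fun _ => H) (Icc 0 1) :=
    fun t ht => (hδ t ht).prodMk (hasDerivWithinAt_const t _ _)
  obtain ⟨Φ, hΦ0, hΦ, hev⟩ := hα.exists_contDiffAt_two hH (hΩ.prod isOpen_univ)
    fun t ht => ⟨hδΩ ht, trivial⟩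
  have hFy : ContDiffAt ℝ 2 F y := hF2.contDiffAt (hΩ.mem_nhds hyΩ)
  have hι : ContDiffAt ℝ 2 (fun y' => (y', w - F y')) y :=
    contDiffAt_id.prodMk (contDiffAt_const.sub hFy)
  have hreach : ∀ᶠ y' in 𝓝 y, Reaches Ω g F w y' (Φ (y', w - F y') 1).1 := by
    have ht : Tendsto (fun y' => (y', w - F y')) (𝓝 y) (𝓝 (δ 0, w - F y)) := by
      rw [h0]
      exact hι.continuousAt
    filter_upwards [ht.eventually hev] with y' hy'
    have hcst : ∀ t ∈ Icc (0 : ℝ) 1, (Φ (y', w - F y') t).2 = w - F y' := fun t ht => by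
      have := constant_of_has_deriv_right_zero
        (f := fun t => (Φ (y', w - F y') t).2)
        (continuous_snd.comp_continuousOn hy'.1.continuousOn)
        (fun t ht => by
          have := (hasFDerivAt_snd (𝕜 := ℝ)).comp_hasDerivWithinAt t
            (hy'.1 t (Ico_subset_Icc_self ht))
          exact this.Ici_of_Icc ht) t ht
      rw [this, hΦ0]
    refine hr.2 ⟨fun t => (Φ (y', w - F y') t).1, by simp [hΦ0], rfl,
      fun t ht => (hy'.2 ht).1, fun t ht => ?_⟩
    have := (hasFDerivAt_fst (𝕜 := ℝ)).comp_hasDerivWithinAt t (hy'.1 t ht)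
    simp only [H, hcst t ht] at this
    exact this
  refine ⟨fun y' => (Φ (y', w - F y') 1).1, ?_, ?_, hreach⟩
  · exact contDiffAt_fst.comp _ (hΦ.contDiffAt.comp y hι)
  · exact hreach.self_of_nhds.unique hΩ (hg.of_le one_le_two) hF2 hpos h

/-- Every point of the curve that is followed leads to the same end point. -/
theorem Reaches.exists_curve {y z : E} (h : Reaches Ω g F w y z) :
    ∃ (γ : ℝ → E) (T : ℝ), γ 0 = y ∧ γ T = z ∧ ∀ t ∈ uIcc 0 T, γ t ∈ Ω ∧
      HasDerivWithinAt γ (g (γ t)) (uIcc 0 T) t ∧ Reaches Ω g F w (γ t) z := by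
  obtain ⟨γ, T, h0, hT, hw, hγ⟩ := h
  refine ⟨γ, T, h0, hT, fun t ht => ⟨(hγ t ht).1, (hγ t ht).2, fun s => γ (t + s), T - t,
    by simp, by simp [hT], hw, ?_⟩⟩
  have hm : MapsTo (fun s => t + s) (uIcc 0 (T - t)) (uIcc 0 T) := fun s hs => by
    rw [mem_uIcc] at *
    rcases ht with ht | ht <;> rcases hs with hs | hs
    · exact Or.inl ⟨by linarith, by linarith⟩
    · exact Or.inl ⟨by linarith, by linarith⟩
    · exact Or.inr ⟨by linarith, by linarith⟩
    · exact Or.inr ⟨by linarith, by linarith⟩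
  intro s hs
  refine ⟨(hγ _ (hm hs)).1, ?_⟩
  have := HasDerivWithinAt.scomp s (hγ _ (hm hs)).2
    ((hasDerivWithinAt_id s (uIcc 0 (T - t))).const_add t) hm
  rwa [one_smul] at this

end Hitting

/-! ### The narrow path algorithm: uniqueness, smoothness and reference manifolds. -/

section NarrowPath

variable {N M : ℕ} {Ω : Set (Signal N)} {f : Fin M → Signal N → ℝ} {v : Fin M → ℝ}

/-- The standing assumptions on a family of features: `C³` functions on an open set with linearly
independent gradients. -/
structure IsRegularFamily (Ω : Set (Signal N)) (f : Fin M → Signal N → ℝ) : Prop where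
  isOpen : IsOpen Ω
  contDiffOn : ∀ j, ContDiffOn ℝ 3 (f j) Ω
  linearIndependent : ∀ x ∈ Ω, LinearIndependent ℝ (fun j => gradient (f j) x)

theorem ContDiffAt.contDiffAt_gradient {E : Type*} [NormedAddCommGroup E] [InnerProductSpace ℝ E]
    [CompleteSpace E] {φ : E → ℝ} {x : E} {m n : WithTop ℕ∞} (h : ContDiffAt ℝ n φ x)
    (hmn : m + 1 ≤ n) : ContDiffAt ℝ m (gradient φ) x :=
  (InnerProductSpace.toDual ℝ E).symm.contDiff.contDiffAt.comp x (h.fderiv_right hmn)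

/-- The Gram–Schmidt form supplies the nonvanishing, the smoothness and the spans of the projected
gradients. -/
theorem projGradient_eq_gramSchmidt (f : Fin M → Signal N → ℝ) (m : Fin M) (x : Signal N) :
    projGradient f m x =
      InnerProductSpace.gramSchmidt ℝ (fun j => gradient (f j) x) m := by
  have hspan := InnerProductSpace.span_gramSchmidt_Iio ℝ (fun j => gradient (f j) x) m
  refine Submodule.eq_starProjection_of_mem_orthogonal' (z := gradient (f m) x -
    InnerProductSpace.gramSchmidt ℝ (fun j => gradient (f j) x) m) ?_ ?_ (by abel)
  · change _ ∈ (Submodule.span ℝ ((fun c => gradient (f c) x) '' Iio m))ᗮ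
    rw [← hspan, Submodule.mem_orthogonal']
    intro u hu
    induction hu using Submodule.span_induction with
    | mem u hu =>
      obtain ⟨b, hb, rfl⟩ := hu
      exact InnerProductSpace.gramSchmidt_orthogonal ℝ _ (ne_of_gt hb)
    | zero => simp
    | add u w _ _ hu hw => rw [inner_add_right, hu, hw, add_zero]
    | smul c u _ hu => rw [inner_smul_right, hu, mul_zero]
  · refine Submodule.le_orthogonal_orthogonal _ ?_
    change _ ∈ Submodule.span ℝ ((fun c => gradient (f c) x) '' Iio m)
    rw [InnerProductSpace.gramSchmidt_def, sub_sub_cancel, ← hspan]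
    refine Submodule.sum_mem _ fun b hb => ?_
    rw [Submodule.starProjection_singleton]
    exact Submodule.smul_mem _ _ (Submodule.subset_span ⟨b, Finset.mem_Iio.1 hb, rfl⟩)

theorem span_projGradient (f : Fin M → Signal N → ℝ) (m : Fin M) (x : Signal N) :
    Submodule.span ℝ ((fun c => projGradient f c x) '' {c | c < m}) =
      Submodule.span ℝ ((fun c => gradient (f c) x) '' {c | c < m}) := by
  simp only [projGradient_eq_gramSchmidt]
  exact InnerProductSpace.span_gramSchmidt_Iio ℝ (fun j => gradient (f j) x) m

theorem inner_gradient_projGradient_of_lt {b m : Fin M} (h : b < m) (x : Signal N) :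
    inner ℝ (gradient (f b) x) (projGradient f m x) = 0 := by
  have : projGradient f m x ∈ refTangent f m x := Submodule.starProjection_apply_mem _ _
  exact (Submodule.mem_orthogonal _ _).1 this _ (Submodule.subset_span ⟨b, h, rfl⟩)

theorem inner_gradient_projGradient_self (m : Fin M) (x : Signal N) :
    inner ℝ (gradient (f m) x) (projGradient f m x) = ‖projGradient f m x‖ ^ 2 := by
  have h := Submodule.starProjection_inner_eq_zero (K := refTangent f m x) (gradient (f m) x)
    (projGradient f m x) (Submodule.starProjection_apply_mem _ _)
  rw [inner_sub_left, sub_eq_zero] at h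
  rw [h, ← real_inner_self_eq_norm_sq]
  rfl

/-- The points of `Ω` on the reference manifold of the first `a` features. -/
def referenceManifold (Ω : Set (Signal N)) (f : Fin M → Signal N → ℝ) (v : Fin M → ℝ) (a : ℕ) :
    Set (Signal N) :=
  {x | x ∈ Ω ∧ ∀ b : Fin M, b.val < a → f b x = v b}

theorem referenceManifold_mono {a b : ℕ} (h : a ≤ b) :
    referenceManifold Ω f v b ⊆ referenceManifold Ω f v a :=
  fun _ hx => ⟨hx.1, fun c hc => hx.2 c (hc.trans_le h)⟩

namespace IsRegularFamily

theorem contDiffAt (h : IsRegularFamily Ω f) (j : Fin M) {x : Signal N} (hx : x ∈ Ω) :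
    ContDiffAt ℝ 3 (f j) x :=
  (h.contDiffOn j).contDiffAt (h.isOpen.mem_nhds hx)

theorem projGradient_ne_zero (h : IsRegularFamily Ω f) (m : Fin M) {x : Signal N} (hx : x ∈ Ω) :
    projGradient f m x ≠ 0 := by
  rw [projGradient_eq_gramSchmidt]
  exact InnerProductSpace.gramSchmidt_ne_zero m (h.linearIndependent x hx)

theorem contDiffAt_projGradient (h : IsRegularFamily Ω f) (m : Fin M) {x : Signal N}
    (hx : x ∈ Ω) : ContDiffAt ℝ 2 (projGradient f m) x := by
  induction m using WellFoundedLT.induction with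
  | ind m ih =>
    have e : projGradient f m = fun y => gradient (f m) y - ∑ b ∈ Finset.Iio m,
        (inner ℝ (projGradient f b y) (gradient (f m) y) / ‖projGradient f b y‖ ^ 2) •
          projGradient f b y := by
      ext1 y
      rw [projGradient_eq_gramSchmidt, InnerProductSpace.gramSchmidt_def]
      simp only [Submodule.starProjection_singleton, projGradient_eq_gramSchmidt]
      rfl
    rw [e]
    have hm : ContDiffAt ℝ 2 (gradient (f m)) x :=
      (h.contDiffAt m hx).contDiffAt_gradient (by norm_num)
    refine hm.sub (ContDiffAt.sum fun b hb => ?_)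
    have hb' := ih b (Finset.mem_Iio.1 hb)
    refine ((hb'.inner ℝ hm).div (hb'.norm_sq ℝ) ?_).smul hb'
    exact pow_ne_zero _ (norm_ne_zero_iff.2 (h.projGradient_ne_zero b hx))

theorem fderiv_projGradient_pos (h : IsRegularFamily Ω f) (m : Fin M) :
    ∀ y ∈ Ω, 0 < fderiv ℝ (f m) y (projGradient f m y) := fun y hy => by
  rw [← inner_gradient_left, inner_gradient_projGradient_self]
  exact pow_pos (norm_pos_iff.2 (h.projGradient_ne_zero m hy)) 2

theorem followsUntil_unique (h : IsRegularFamily Ω f) {m : Fin M} {y z z' : Signal N}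
    (hz : FollowsUntil Ω f v m y z) (hz' : FollowsUntil Ω f v m y z') : z = z' :=
  Reaches.unique (g := projGradient f m) (F := f m) h.isOpen
    (fun _ hx => ((h.contDiffAt_projGradient m hx).of_le one_le_two).contDiffWithinAt)
    ((h.contDiffOn m).of_le (by norm_num)) (h.fderiv_projGradient_pos m) hz hz'

theorem followsUntil_exists_contDiffAt (h : IsRegularFamily Ω f) {m : Fin M} {y z : Signal N}
    (hz : FollowsUntil Ω f v m y z) : ∃ P : Signal N → Signal N, ContDiffAt ℝ 2 P y ∧ P y = z ∧
      ∀ᶠ y' in 𝓝 y, FollowsUntil Ω f v m y' (P y') :=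
  Reaches.exists_contDiffAt (g := projGradient f m) (F := f m) h.isOpen
    (fun _ hx => (h.contDiffAt_projGradient m hx).contDiffWithinAt)
    (h.contDiffOn m) (h.fderiv_projGradient_pos m) hz

theorem narrowPath_unique (h : IsRegularFamily Ω f) {m : ℕ} {x y y' : Signal N}
    (hy : NarrowPath Ω f v m x y) (hy' : NarrowPath Ω f v m x y') : y = y' := by
  induction m generalizing y y' with
  | zero => exact hy.2.trans hy'.2.symm
  | succ m ih =>
    obtain ⟨hm, z, hz, hzy⟩ := hy
    obtain ⟨_, z', hz', hzy'⟩ := hy'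
    obtain rfl := ih hz hz'
    exact h.followsUntil_unique hzy hzy'

theorem narrowPath_exists_contDiffAt (h : IsRegularFamily Ω f) {m : ℕ} {x y : Signal N}
    (hy : NarrowPath Ω f v m x y) : ∃ P : Signal N → Signal N, ContDiffAt ℝ 2 P x ∧ P x = y ∧
      ∀ᶠ x' in 𝓝 x, NarrowPath Ω f v m x' (P x') := by
  induction m generalizing y with
  | zero =>
    refine ⟨id, contDiffAt_id, hy.2.symm, ?_⟩
    filter_upwards [h.isOpen.mem_nhds hy.1] with x' hx'
    exact ⟨hx', rfl⟩
  | succ m ih =>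
    obtain ⟨hm, z, hz, hzy⟩ := hy
    obtain ⟨P, hP, rfl, hev⟩ := ih hz
    obtain ⟨Q, hQ, hQy, hev'⟩ := h.followsUntil_exists_contDiffAt hzy
    refine ⟨Q ∘ P, hQ.comp x hP, hQy, ?_⟩
    filter_upwards [hev, hP.continuousAt.eventually hev'] with x' h1 h2
    exact ⟨hm, P x', h1, h2⟩

theorem narrowMap_eq (h : IsRegularFamily Ω f) {m : ℕ} {x y : Signal N}
    (hy : NarrowPath Ω f v m x y) : narrowMap Ω f v m x = y := by
  have hex : ∃ y, NarrowPath Ω f v m x y := ⟨y, hy⟩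
  rw [narrowMap, dif_pos hex]
  exact h.narrowPath_unique hex.choose_spec hy

theorem isOpen_narrowDomain (h : IsRegularFamily Ω f) : IsOpen (narrowDomain Ω f v) := by
  refine isOpen_iff_mem_nhds.2 fun x hx => ?_
  have : ∀ j : Fin M, ∀ᶠ x' in 𝓝 x, ∃ y, NarrowPath Ω f v j x' y := fun j => by
    obtain ⟨y, hy⟩ := hx.2 j
    obtain ⟨P, -, -, hev⟩ := h.narrowPath_exists_contDiffAt hy
    exact hev.mono fun x' hx' => ⟨_, hx'⟩
  filter_upwards [h.isOpen.mem_nhds hx.1, eventually_all.2 this] with x' h1 h2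
  exact ⟨h1, h2⟩

/-- The field is orthogonal to the gradients of the earlier features, so these keep their reference
values along the curve. -/
theorem followsUntil_exists_curve (h : IsRegularFamily Ω f) {m : Fin M} {y z : Signal N}
    (hz : FollowsUntil Ω f v m y z) (hy : y ∈ referenceManifold Ω f v m) :
    ∃ (γ : ℝ → Signal N) (T : ℝ), γ 0 = y ∧ γ T = z ∧ ∀ t ∈ uIcc 0 T,
      γ t ∈ referenceManifold Ω f v m ∧
      HasDerivWithinAt γ (projGradient f m (γ t)) (uIcc 0 T) t ∧
      FollowsUntil Ω f v m (γ t) z := by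
  obtain ⟨γ, T, h0, hT, hγ⟩ := Reaches.exists_curve (g := projGradient f m) (F := f m) hz
  refine ⟨γ, T, h0, hT, fun t ht => ⟨⟨(hγ t ht).1, fun b hb => ?_⟩, (hγ t ht).2.1, (hγ t ht).2.2⟩⟩
  have hd : ∀ s ∈ uIcc 0 T, HasDerivWithinAt (fun s => f b (γ s)) 0 (uIcc 0 T) s := fun s hs => by
    have h1 := ((h.contDiffAt b (hγ s hs).1).differentiableAt
      (by norm_num)).hasFDerivAt.comp_hasDerivWithinAt s (hγ s hs).2.1
    refine h1.congr_deriv ?_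
    rw [← inner_gradient_left, inner_gradient_projGradient_of_lt hb]
  have := (convex_uIcc (0 : ℝ) T).norm_image_sub_le_of_norm_hasDerivWithin_le (C := 0) hd
    (by simp) left_mem_uIcc ht
  rw [zero_mul, norm_le_zero_iff, sub_eq_zero, h0, hy.2 b hb] at this
  exact this

theorem followsUntil_mem_referenceManifold (h : IsRegularFamily Ω f) {m : Fin M}
    {y z : Signal N} (hz : FollowsUntil Ω f v m y z) (hy : y ∈ referenceManifold Ω f v m) :
    z ∈ referenceManifold Ω f v (m + 1) := by
  obtain ⟨γ, T, -, rfl, hγ⟩ := h.followsUntil_exists_curve hz hy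
  obtain ⟨_, _, _, _, hw, _⟩ := hz
  refine ⟨(hγ T right_mem_uIcc).1.1, fun b hb => ?_⟩
  rcases (Nat.lt_succ_iff.1 hb).lt_or_eq with hb | hb
  · exact (hγ T right_mem_uIcc).1.2 b hb
  · obtain rfl := Fin.ext hb
    exact hw

theorem narrowPath_mem_referenceManifold (h : IsRegularFamily Ω f) {m : ℕ} {x y : Signal N}
    (hy : NarrowPath Ω f v m x y) : y ∈ referenceManifold Ω f v m := by
  induction m generalizing y with
  | zero => exact ⟨hy.2 ▸ hy.1, fun b hb => absurd hb (Nat.not_lt_zero _)⟩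
  | succ m ih =>
    obtain ⟨hm, z, hz, hzy⟩ := hy
    exact h.followsUntil_mem_referenceManifold hzy (ih hz)

theorem contDiffAt_hatFeature (h : IsRegularFamily Ω f) (j : Fin M) {x : Signal N}
    (hx : x ∈ narrowDomain Ω f v) : ContDiffAt ℝ 2 (hatFeature Ω f v j) x := by
  obtain ⟨y, hy⟩ := hx.2 j
  obtain ⟨P, hP, rfl, hev⟩ := h.narrowPath_exists_contDiffAt hy
  have hfj : ContDiffAt ℝ 2 (f j) (P x) :=
    (h.contDiffAt j (h.narrowPath_mem_referenceManifold hy).1).of_le (by norm_num)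
  refine (hfj.comp x hP).congr_of_eventuallyEq ?_
  filter_upwards [hev] with x' hx'
  rw [hatFeature, h.narrowMap_eq hx', Function.comp_apply]

end IsRegularFamily

theorem followsUntil_self {m : Fin M} {y : Signal N}
    (hy : y ∈ referenceManifold Ω f v (m + 1)) : FollowsUntil Ω f v m y y := by
  refine ⟨fun _ => y, 0, rfl, rfl, hy.2 m (Nat.lt_succ_self _), fun t ht => ⟨hy.1, ?_⟩⟩
  rw [uIcc_self]
  simp [hasDerivWithinAt_iff_hasFDerivWithinAt, HasFDerivWithinAt.of_subsingleton]

theorem narrowPath_self {m : ℕ} (hm : m ≤ M) {y : Signal N}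
    (hy : y ∈ referenceManifold Ω f v m) : NarrowPath Ω f v m y y := by
  induction m with
  | zero => exact ⟨hy.1, rfl⟩
  | succ m ih =>
    exact ⟨hm, y, ih (Nat.le_of_succ_le hm) (referenceManifold_mono m.le_succ hy),
      followsUntil_self hy⟩

theorem NarrowPath.exists_of_le {m n : ℕ} (hmn : m ≤ n) {x w : Signal N}
    (hw : NarrowPath Ω f v n x w) : ∃ y, NarrowPath Ω f v m x y := by
  induction n, hmn using Nat.le_induction generalizing w with
  | base => exact ⟨w, hw⟩
  | succ n _ ih =>
    obtain ⟨_, z, hz, _⟩ := hw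
    exact ih hz

namespace IsRegularFamily

/-- Paths that have met after `m` steps stay together. -/
theorem narrowPath_of_meet (h : IsRegularFamily Ω f) {m n : ℕ} (hmn : m ≤ n)
    {x x' y w : Signal N} (hy : NarrowPath Ω f v m x y) (hy' : NarrowPath Ω f v m x' y)
    (hw : NarrowPath Ω f v n x w) : NarrowPath Ω f v n x' w := by
  induction n, hmn using Nat.le_induction generalizing w with
  | base => rwa [h.narrowPath_unique hw hy]
  | succ n _ ih =>
    obtain ⟨hn, z, hz, hzw⟩ := hw
    exact ⟨hn, z, ih hz, hzw⟩

theorem mem_narrowDomain_of_meet (h : IsRegularFamily Ω f) {m : ℕ} {x x' y : Signal N}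
    (hx : x ∈ narrowDomain Ω f v) (hx' : x' ∈ Ω) (hy : NarrowPath Ω f v m x y)
    (hy' : NarrowPath Ω f v m x' y) : x' ∈ narrowDomain Ω f v := by
  refine ⟨hx', fun j => ?_⟩
  rcases le_total m j with hj | hj
  · exact (hx.2 j).imp fun w hw => h.narrowPath_of_meet hj hy hy' hw
  · exact hy'.exists_of_le hj

theorem hatFeature_eq_of_meet (h : IsRegularFamily Ω f) {m : ℕ} {x x' y : Signal N} {j : Fin M}
    (hmj : m ≤ j) (hx : x ∈ narrowDomain Ω f v) (hy : NarrowPath Ω f v m x y)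
    (hy' : NarrowPath Ω f v m x' y) : hatFeature Ω f v j x' = hatFeature Ω f v j x := by
  obtain ⟨w, hw⟩ := hx.2 j
  rw [hatFeature, hatFeature, h.narrowMap_eq hw,
    h.narrowMap_eq (h.narrowPath_of_meet hmj hy hy' hw)]

theorem hatFeature_eq_of_mem_referenceManifold (h : IsRegularFamily Ω f) {j : Fin M}
    {x : Signal N} (hx : x ∈ referenceManifold Ω f v j) : hatFeature Ω f v j x = f j x := by
  rw [hatFeature, h.narrowMap_eq (narrowPath_self j.2.le hx)]

/-- The step of the algorithm that adjusts the feature `a`, as seen by the later output features,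
from a point where the earlier features are already normalized. -/
theorem exists_normalizing_curve (h : IsRegularFamily Ω f) {a j : Fin M} (haj : a < j)
    {y : Signal N} (hy : y ∈ narrowDomain Ω f v) (hya : y ∈ referenceManifold Ω f v a) :
    ∃ (γ : ℝ → Signal N) (T : ℝ), γ 0 = y ∧ γ T ∈ referenceManifold Ω f v (a + 1) ∧
      ∀ t ∈ uIcc 0 T, γ t ∈ narrowDomain Ω f v ∧ γ t ∈ referenceManifold Ω f v a ∧
        HasDerivWithinAt γ (projGradient f a (γ t)) (uIcc 0 T) t ∧
        hatFeature Ω f v j (γ t) = hatFeature Ω f v j y := by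
  have hself := narrowPath_self a.2.le hya
  obtain ⟨w, hw⟩ := hy.2 j
  obtain ⟨z, hz⟩ := hw.exists_of_le (m := a + 1) haj
  obtain ⟨_, y', hy', hyz⟩ := id hz
  -- The first `a` steps leave `y` fixed, so step `a` starts at `y` itself. All points of its curve
  -- then lead to the same `z`, and `a + 1 ≤ j` makes `hatFeature` `j` depend on `z` only.
  obtain rfl := h.narrowPath_unique hself hy'
  obtain ⟨γ, T, h0, hT, hγ⟩ := h.followsUntil_exists_curve hyz hya
  refine ⟨γ, T, h0, hT ▸ h.followsUntil_mem_referenceManifold hyz hya, fun t ht => ?_⟩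
  obtain ⟨h1, h2, h3⟩ := hγ t ht
  have hp : NarrowPath Ω f v (a + 1) (γ t) z := ⟨a.2, γ t, narrowPath_self a.2.le h1, h3⟩
  exact ⟨h.mem_narrowDomain_of_meet hy h1.1 hz hp, h1, h2,
    h.hatFeature_eq_of_meet haj hy hz hp⟩

end IsRegularFamily

end NarrowPath

/-- Only the `X i` component of `u` contributes to either side. The factor `‖X i‖ ^ 2` replaces a
division and so admits `X i = 0`. -/
theorem norm_sq_mul_inner_of_mem_span {E : Type*} [NormedAddCommGroup E]
    [InnerProductSpace ℝ E] {ι : Type*} {X : ι → E} {I : Set ι} {i : ι} {F u : E}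
    (hX : ∀ c ∈ I, c ≠ i → inner ℝ (X c) (X i) = 0) (hF : ∀ c ∈ I, c ≠ i → inner ℝ (X c) F = 0)
    (hu : u ∈ Submodule.span ℝ (X '' I)) :
    ‖X i‖ ^ 2 * inner ℝ u F = inner ℝ u (X i) * inner ℝ (X i) F := by
  induction hu using Submodule.span_induction with
  | mem u hu =>
    obtain ⟨c, hc, rfl⟩ := hu
    rcases eq_or_ne c i with rfl | hne
    · rw [real_inner_self_eq_norm_sq]
    · rw [hX c hc hne, hF c hc hne, mul_zero, zero_mul]
  | zero => simp
  | add u w _ _ hu hw => rw [inner_add_left, inner_add_left, mul_add, hu, hw, add_mul]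
  | smul r u _ hu => rw [real_inner_smul_left, real_inner_smul_left]; linear_combination r * hu

/-! ### Orthogonal gradient fields and transport of orthogonality. -/

section Hessian

variable {E : Type*} [NormedAddCommGroup E] [InnerProductSpace ℝ E] [CompleteSpace E]

theorem ContDiffAt.inner_fderiv_gradient_comm {φ : E → ℝ} {x : E} (h : ContDiffAt ℝ 2 φ x)
    (u w : E) : Inner.inner ℝ (fderiv ℝ (gradient φ) x u) w =
      Inner.inner ℝ (fderiv ℝ (gradient φ) x w) u := by
  have key (u w : E) :
      Inner.inner ℝ (fderiv ℝ (gradient φ) x u) w = fderiv ℝ (fderiv ℝ φ) x u w := by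
    have h1 := ((h.contDiffAt_gradient (m := 1) (by norm_num)).differentiableAt
      one_ne_zero).hasFDerivAt.inner ℝ (hasFDerivAt_const w x)
    have h2 := ((h.fderiv_right (m := 1) (by norm_num)).differentiableAt
      one_ne_zero).hasFDerivAt.clm_apply (hasFDerivAt_const w x)
    have e : (fun y => Inner.inner ℝ (gradient φ y) w) = fun y => fderiv ℝ φ y w := by
      ext1 y
      exact inner_gradient_left
    rw [e] at h1
    have := congrArg (fun A : E →L[ℝ] ℝ => A u) (h1.unique h2)
    simpa using this
  rw [key, key]
  exact h.isSymmSndFDerivAt (by simp) u w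

/-- If two gradient fields are orthogonal on an open set, then the derivative of one along the
other is antisymmetric in the two. -/
theorem fderiv_gradient_apply_gradient_of_orthogonal {φ ψ : E → ℝ} {x : E}
    (hφ : ContDiffAt ℝ 2 φ x) (hψ : ContDiffAt ℝ 2 ψ x)
    (h : ∀ᶠ y in 𝓝 x, inner ℝ (gradient φ y) (gradient ψ y) = 0) :
    fderiv ℝ (gradient ψ) x (gradient φ x) = -fderiv ℝ (gradient φ) x (gradient ψ x) := by
  have hd := ((hφ.contDiffAt_gradient (m := 1) (by norm_num)).differentiableAt
    one_ne_zero).hasFDerivAt.inner ℝ ((hψ.contDiffAt_gradient (m := 1) (by norm_num)).differentiableAt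
    one_ne_zero).hasFDerivAt
  have h0 : HasFDerivAt (fun y => inner ℝ (gradient φ y) (gradient ψ y)) (0 : E →L[ℝ] ℝ) x :=
    (hasFDerivAt_const (0 : ℝ) x).congr_of_eventuallyEq h
  refine ext_inner_right ℝ fun u => ?_
  have := congrArg (fun A : E →L[ℝ] ℝ => A u) (hd.unique h0)
  simp only [ContinuousLinearMap.comp_apply, ContinuousLinearMap.prod_apply,
    fderivInnerCLM_apply, _root_.zero_apply] at this
  rw [hψ.inner_fderiv_gradient_comm, inner_neg_left, hφ.inner_fderiv_gradient_comm]
  rw [real_inner_comm] at this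
  linarith

/-- Orthogonality of two gradients propagates along the flow of a third gradient field that is
orthogonal to both, if the bracket of the third field with the first one has no component that
contributes a new direction. -/
theorem inner_gradient_eq_zero_of_integralCurve {φ χ ψ : E → ℝ} {S : Set E} (hS : IsOpen S)
    (hφ : ∀ x ∈ S, ContDiffAt ℝ 2 φ x) (hχ : ∀ x ∈ S, ContDiffAt ℝ 2 χ x)
    (hψ : ∀ x ∈ S, ContDiffAt ℝ 2 ψ x)
    (hφχ : ∀ x ∈ S, inner ℝ (gradient φ x) (gradient χ x) = 0)
    (hφψ : ∀ x ∈ S, inner ℝ (gradient φ x) (gradient ψ x) = 0)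
    (hbr : ∀ x ∈ S, ‖gradient χ x‖ ^ 2 *
        inner ℝ (fderiv ℝ (gradient φ) x (gradient χ x)) (gradient ψ x) =
      inner ℝ (fderiv ℝ (gradient φ) x (gradient χ x)) (gradient χ x) *
        inner ℝ (gradient χ x) (gradient ψ x))
    {c : ℝ → E} {κ : ℝ} (hcS : MapsTo c (Icc 0 1) S)
    (hc : ∀ t ∈ Icc (0 : ℝ) 1, HasDerivWithinAt c (κ • gradient φ (c t)) (Icc 0 1) t)
    (h0 : inner ℝ (gradient χ (c 0)) (gradient ψ (c 0)) = 0) :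
    inner ℝ (gradient χ (c 1)) (gradient ψ (c 1)) = 0 := by
  have hcc : ContinuousOn c (Icc 0 1) := fun t ht => (hc t ht).continuousWithinAt
  have hD : ContinuousOn (fun t => fderiv ℝ (gradient φ) (c t)) (Icc 0 1) := fun t ht =>
    (((hφ _ (hcS ht)).contDiffAt_gradient (m := 1) (by norm_num)).continuousAt_fderiv
      one_ne_zero).comp_continuousWithinAt (hcc t ht)
  obtain ⟨B, hB⟩ := isCompact_Icc.exists_bound_of_continuousOn hD
  have hgrad {θ : E → ℝ} (hθ : ∀ x ∈ S, ContDiffAt ℝ 2 θ x)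
      (hφθ : ∀ x ∈ S, inner ℝ (gradient φ x) (gradient θ x) = 0) (t : ℝ)
      (ht : t ∈ Icc (0 : ℝ) 1) : HasDerivWithinAt (fun t => gradient θ (c t))
        (-κ • fderiv ℝ (gradient φ) (c t) (gradient θ (c t))) (Icc 0 1) t := by
    have h1 := (((hθ _ (hcS ht)).contDiffAt_gradient (m := 1) (by norm_num)).differentiableAt
      one_ne_zero).hasFDerivAt.comp_hasDerivWithinAt t (hc t ht)
    refine h1.congr_deriv ?_
    rw [map_smul, fderiv_gradient_apply_gradient_of_orthogonal (hφ _ (hcS ht)) (hθ _ (hcS ht)),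
      smul_neg, neg_smul]
    filter_upwards [hS.mem_nhds (hcS ht)] with y hy using hφθ y hy
  have hq (t : ℝ) (ht : t ∈ Icc (0 : ℝ) 1) :
      HasDerivWithinAt (fun t => inner ℝ (gradient χ (c t)) (gradient ψ (c t)))
        (-2 * κ * inner ℝ (fderiv ℝ (gradient φ) (c t) (gradient χ (c t))) (gradient ψ (c t)))
        (Icc 0 1) t := by
    refine ((hgrad hχ hφχ t ht).inner ℝ (hgrad hψ hφψ t ht)).congr_deriv ?_
    rw [real_inner_smul_left, real_inner_smul_right, real_inner_comm _ (gradient χ (c t)),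
      (hφ _ (hcS ht)).inner_fderiv_gradient_comm (gradient ψ (c t))]
    ring
  refine eq_zero_of_abs_deriv_le_mul_abs_self_of_eq_zero_right (a := 0) (b := 1)
    (f := fun t => inner ℝ (gradient χ (c t)) (gradient ψ (c t))) (K := 2 * |κ| * B)
    (fun t ht => (hq t ht).continuousWithinAt)
    (fun t ht => (hq t (Ico_subset_Icc_self ht)).Ici_of_Icc ht) h0 (fun t ht => ?_) 1 (by simp)
  replace ht := Ico_subset_Icc_self ht
  rw [norm_mul, norm_mul, norm_neg, Real.norm_ofNat, Real.norm_eq_abs, mul_assoc (2 * |κ|)]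
  gcongr
  rcases eq_or_ne (gradient χ (c t)) 0 with hz | hz
  · simp [hz]
  · have hpos : 0 < ‖gradient χ (c t)‖ ^ 2 := pow_pos (norm_pos_iff.2 hz) 2
    -- By `hbr` and Cauchy–Schwarz, `‖∇χ‖²` times the left side is at most `B ‖∇χ‖²` times `|⟨∇χ,
    -- ∇ψ⟩|`, where `B` bounds the Hessian of `φ` along the curve.
    refine le_of_mul_le_mul_left ?_ hpos
    rw [← Real.norm_of_nonneg hpos.le, ← norm_mul, hbr _ (hcS ht), norm_mul, ← mul_assoc,
      Real.norm_of_nonneg hpos.le]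
    gcongr
    refine (norm_inner_le_norm _ _).trans ?_
    rw [sq, mul_comm (_ * _) B, ← mul_assoc]
    gcongr
    exact (ContinuousLinearMap.le_opNorm _ _).trans (by gcongr; exact hB t ht)

end Hessian

/-! ### Gradients of the output features and the decoupling theorem. -/

section Decoupling

variable {N M : ℕ} {Ω : Set (Signal N)} {f : Fin M → Signal N → ℝ} {v : Fin M → ℝ}

namespace IsRegularFamily

/-- If `f a` is not yet at its reference value, the normalizing curve has nonzero length, and
`hatFeature` `j` is constant along it; its derivative at the starting point is the inner product. -/
theorem inner_gradient_hatFeature_projGradient_of_ne (h : IsRegularFamily Ω f) {a j : Fin M}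
    (haj : a < j) {y : Signal N} (hy : y ∈ narrowDomain Ω f v)
    (hya : y ∈ referenceManifold Ω f v a) (hne : f a y ≠ v a) :
    inner ℝ (gradient (hatFeature Ω f v j) y) (projGradient f a y) = 0 := by
  obtain ⟨γ, T, h0, hT, hγ⟩ := h.exists_normalizing_curve haj hy hya
  have hT0 : T ≠ 0 := fun hT0 => hne (by
    rw [← h0, ← hT0]
    exact hT.2 a (Nat.lt_succ_self _))
  obtain ⟨-, -, hd, -⟩ := hγ 0 left_mem_uIcc
  rw [h0] at hd
  have h1 := (h0.symm ▸ ((h.contDiffAt_hatFeature j hy).differentiableAt two_ne_zero).hasFDerivAt :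
    HasFDerivAt (hatFeature Ω f v j) (fderiv ℝ (hatFeature Ω f v j) y) (γ 0)).comp_hasDerivWithinAt
    0 hd
  have h2 : HasDerivWithinAt (hatFeature Ω f v j ∘ γ) 0 (uIcc 0 T) 0 :=
    (hasDerivWithinAt_const 0 (uIcc 0 T) (hatFeature Ω f v j y)).congr
      (fun t ht => (hγ t ht).2.2.2) (by rw [Function.comp_apply, h0])
  have hu : UniqueDiffWithinAt ℝ (uIcc 0 T) 0 :=
    uniqueDiffOn_Icc (min_lt_max.2 hT0.symm) 0 left_mem_uIcc
  rw [inner_gradient_left]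
  exact hu.eq_deriv _ h1 h2

/-- Later output features are stationary along the direction in which the feature `a` is
adjusted. -/
theorem inner_gradient_hatFeature_projGradient (h : IsRegularFamily Ω f) {a j : Fin M}
    (haj : a < j) {y : Signal N} (hy : y ∈ narrowDomain Ω f v)
    (hya : y ∈ referenceManifold Ω f v a) :
    inner ℝ (gradient (hatFeature Ω f v j) y) (projGradient f a y) = 0 := by
  have hg := h.contDiffAt_projGradient a hya.1
  obtain ⟨c, hc0, ε, hε, hc⟩ := (hg.of_le
    one_le_two).exists_forall_mem_closedBall_exists_eq_forall_mem_Ioo_hasDerivAt₀ 0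
  have hcd0 := hc 0 (by simpa using hε)
  have hcΩ : ∀ᶠ t in 𝓝 0, c t ∈ narrowDomain Ω f v :=
    hcd0.continuousAt.eventually_mem (hc0.symm ▸ h.isOpen_narrowDomain.mem_nhds hy)
  obtain ⟨δ, hδ, hball⟩ := Metric.eventually_nhds_iff_ball.1
    (hcΩ.and (Ioo_mem_nhds (show 0 - ε < 0 by linarith) (show (0 : ℝ) < 0 + ε by linarith)))
  have hman : ∀ t ∈ ball (0 : ℝ) δ, c t ∈ referenceManifold Ω f v a := fun t ht => by
    refine ⟨(hball t ht).1.1, fun b hb => ?_⟩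
    have hd : ∀ s ∈ ball (0 : ℝ) δ, HasDerivWithinAt (fun s => f b (c s)) 0 (ball 0 δ) s :=
      fun s hs => by
        have h1 := ((h.contDiffAt b (hball s hs).1.1).differentiableAt
          (by norm_num)).hasFDerivAt.comp_hasDerivWithinAt s
            (hc s (hball s hs).2).hasDerivWithinAt (s := ball 0 δ)
        refine h1.congr_deriv ?_
        rw [← inner_gradient_left, inner_gradient_projGradient_of_lt hb]
    have := (convex_ball (0 : ℝ) δ).norm_image_sub_le_of_norm_hasDerivWithin_le (C := 0) hd
      (by simp) (mem_ball_self hδ) ht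
    rw [zero_mul, norm_le_zero_iff, sub_eq_zero, hc0, hya.2 b hb] at this
    exact this
  have hda : HasDerivAt (fun t => f a (c t)) (fderiv ℝ (f a) y (projGradient f a y)) 0 := by
    have h1 : HasFDerivAt (f a) (fderiv ℝ (f a) y) (c 0) := by
      rw [hc0]
      exact ((h.contDiffAt a hya.1).differentiableAt (by norm_num)).hasFDerivAt
    rw [hc0] at hcd0
    exact h1.comp_hasDerivAt 0 hcd0
  -- When `f a y = v a` the normalizing curve may be a single point. But `f a` has nonzero
  -- derivative along `c`, so nearby points of `c` other than `y` are off the level `v a`, and the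
  -- identity passes to the limit.
  have hzero : ∀ᶠ t in 𝓝[≠] (0 : ℝ),
      inner ℝ (gradient (hatFeature Ω f v j) (c t)) (projGradient f a (c t)) = 0 := by
    filter_upwards [hda.eventually_ne (c := v a) (h.fderiv_projGradient_pos a y hya.1).ne',
      nhdsWithin_le_nhds (ball_mem_nhds 0 hδ)] with t ht htb
    exact h.inner_gradient_hatFeature_projGradient_of_ne haj (hball t htb).1 (hman t htb) ht
  have hcont : ContinuousAt
      (fun t => inner ℝ (gradient (hatFeature Ω f v j) (c t)) (projGradient f a (c t))) 0 := by
    have h1 : ContinuousAt (gradient (hatFeature Ω f v j)) y :=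
      ((h.contDiffAt_hatFeature j hy).contDiffAt_gradient (m := 1) (by norm_num)).continuousAt
    exact (h1.comp_of_eq hcd0.continuousAt hc0).inner
      (hg.continuousAt.comp_of_eq hcd0.continuousAt hc0)
  have hlim := tendsto_nhds_unique (hcont.tendsto.mono_left nhdsWithin_le_nhds)
    (tendsto_const_nhds.congr' (hzero.mono fun t ht => ht.symm))
  rwa [hc0] at hlim

theorem gradient_hatFeature_sub_mem_span (h : IsRegularFamily Ω f) {a : Fin M} {y : Signal N}
    (hy : y ∈ narrowDomain Ω f v) (hya : y ∈ referenceManifold Ω f v a) :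
    gradient (f a) y - gradient (hatFeature Ω f v a) y ∈
      Submodule.span ℝ ((fun c => gradient (f c) y) '' {c | c < a}) := by
  have hstrict (j : Fin M) : HasStrictFDerivAt (f j) (fderiv ℝ (f j) y) y :=
    (h.contDiffAt j hya.1).hasStrictFDerivAt (by norm_num)
  have hhat := (h.contDiffAt_hatFeature a hy).hasStrictFDerivAt two_ne_zero
  -- The difference vanishes on the level set of the earlier features, so each of its points there
  -- is a constrained extremum. Linear independence of the gradients then excludes a zero multiplier
  -- `c₀`.
  have hextr : IsLocalExtrOn (fun x => f a x - hatFeature Ω f v a x)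
      {x | ∀ b : {b : Fin M // b < a}, f b x = f b y} y := by
    refine Or.inl ?_
    filter_upwards [self_mem_nhdsWithin, nhdsWithin_le_nhds (h.isOpen.mem_nhds hya.1)] with x hx hxΩ
    have hxa : x ∈ referenceManifold Ω f v a :=
      ⟨hxΩ, fun b hb => (hx ⟨b, hb⟩).trans (hya.2 b hb)⟩
    rw [h.hatFeature_eq_of_mem_referenceManifold hya, h.hatFeature_eq_of_mem_referenceManifold hxa,
      sub_self, sub_self]
  obtain ⟨c, c₀, hne, hsum⟩ := hextr.exists_multipliers_of_hasStrictFDerivAt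
    (fun b => hstrict b) ((hstrict a).sub hhat)
  have hvec : (∑ b : {b : Fin M // b < a}, c b • gradient (f b) y) +
      c₀ • (gradient (f a) y - gradient (hatFeature Ω f v a) y) = 0 := by
    refine ext_inner_right ℝ fun u => ?_
    have := congrArg (fun A : Signal N →L[ℝ] ℝ => A u) hsum
    simpa [inner_add_left, sum_inner, inner_sub_left, real_inner_smul_left,
      inner_gradient_left] using this
  have hc₀ : c₀ ≠ 0 := by
    rintro rfl
    rw [zero_smul, add_zero] at hvec
    have hli := (h.linearIndependent y hya.1).comp (Subtype.val : {b : Fin M // b < a} → Fin M)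
      Subtype.val_injective
    refine hne (Prod.ext (funext fun b => ?_) rfl)
    exact Fintype.linearIndependent_iff.1 hli c hvec b
  have : gradient (f a) y - gradient (hatFeature Ω f v a) y =
      -(c₀⁻¹ • ∑ b : {b : Fin M // b < a}, c b • gradient (f b) y) := by
    rw [eq_neg_of_add_eq_zero_left hvec, smul_neg, neg_neg, inv_smul_smul₀ hc₀]
  rw [this]
  refine Submodule.neg_mem _ (Submodule.smul_mem _ _ (Submodule.sum_mem _ fun b _ => ?_))
  exact Submodule.smul_mem _ _ (Submodule.subset_span ⟨b, b.2, rfl⟩)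

/-- On the reference manifold of the earlier features, the gradient of an output feature is the
direction in which the algorithm adjusts the feature. -/
theorem gradient_hatFeature_eq_projGradient (h : IsRegularFamily Ω f) {a : Fin M} {y : Signal N}
    (hy : y ∈ narrowDomain Ω f v) (hya : y ∈ referenceManifold Ω f v a) :
    gradient (hatFeature Ω f v a) y = projGradient f a y := by
  refine (Submodule.eq_starProjection_of_mem_orthogonal ?_ ?_).symm
  · rw [refTangent, ← span_projGradient, Submodule.mem_orthogonal']
    intro u hu
    induction hu using Submodule.span_induction with
    | mem u hu =>
      obtain ⟨b, hb, rfl⟩ := hu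
      exact h.inner_gradient_hatFeature_projGradient hb hy
        (referenceManifold_mono (Fin.le_def.1 (le_of_lt hb)) hya)
    | zero => simp
    | add u w _ _ hu hw => rw [inner_add_right, hu, hw, add_zero]
    | smul c u _ hu => rw [inner_smul_right, hu, mul_zero]
  · exact Submodule.le_orthogonal_orthogonal _ (h.gradient_hatFeature_sub_mem_span hy hya)

/-- An output feature is orthogonal to all later ones, if the Frobenius condition holds for the
output features up to it. -/
theorem inner_gradient_hatFeature (h : IsRegularFamily Ω f) (i : Fin M)
    (hfrob : ∀ b ≤ i, 0 < b.val →
      FrobeniusOn (hatFeature Ω f v) {c | c.val < b.val + 1} (narrowDomain Ω f v)) :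
    ∀ j, i < j → ∀ x ∈ narrowDomain Ω f v,
      inner ℝ (gradient (hatFeature Ω f v i) x) (gradient (hatFeature Ω f v j) x) = 0 := by
  induction i using WellFoundedLT.induction with
  | ind i ih =>
    replace ih : ∀ a < i, ∀ j, a < j → ∀ x ∈ narrowDomain Ω f v,
        inner ℝ (gradient (hatFeature Ω f v a) x) (gradient (hatFeature Ω f v j) x) = 0 :=
      fun a ha => ih a ha fun b hb => hfrob b (hb.trans ha.le)
    intro j hij
    have hbr (a : Fin M) (ha : a < i) (x : Signal N) (hx : x ∈ narrowDomain Ω f v) :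
        ‖gradient (hatFeature Ω f v i) x‖ ^ 2 *
          inner ℝ (fderiv ℝ (gradient (hatFeature Ω f v a)) x (gradient (hatFeature Ω f v i) x))
            (gradient (hatFeature Ω f v j) x) =
        inner ℝ (fderiv ℝ (gradient (hatFeature Ω f v a)) x (gradient (hatFeature Ω f v i) x))
            (gradient (hatFeature Ω f v i) x) *
          inner ℝ (gradient (hatFeature Ω f v i) x) (gradient (hatFeature Ω f v j) x) := by
      have hmem := hfrob i le_rfl (Nat.zero_lt_of_lt ha) x hx a (Nat.lt_succ_of_lt ha) i
        (Nat.lt_succ_self _)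
      rw [VectorField.lieBracket, fderiv_gradient_apply_gradient_of_orthogonal
        (h.contDiffAt_hatFeature a hx) (h.contDiffAt_hatFeature i hx)
        (by filter_upwards [h.isOpen_narrowDomain.mem_nhds hx] with y hy using ih a ha i ha y hy)]
        at hmem
      have hlt (c : Fin M) (hc : c.val < i.val + 1) (hci : c ≠ i) : c < i :=
        lt_of_le_of_ne (Nat.lt_succ_iff.1 hc) hci
      have := norm_sq_mul_inner_of_mem_span (i := i) (F := gradient (hatFeature Ω f v j) x)
        (X := fun c => gradient (hatFeature Ω f v c) x)
        (fun c hc hci => ih c (hlt c hc hci) i (hlt c hc hci) x hx)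
        (fun c hc hci => ih c (hlt c hc hci) j ((hlt c hc hci).trans hij) x hx) hmem
      simp only [inner_sub_left, inner_neg_left] at this
      linarith
    -- `n` counts the steps left before the reference manifold of the features below `i` is reached.
    have main (n : ℕ) : ∀ a : ℕ, a + n = i → ∀ y ∈ narrowDomain Ω f v,
        y ∈ referenceManifold Ω f v a →
        inner ℝ (gradient (hatFeature Ω f v i) y) (gradient (hatFeature Ω f v j) y) = 0 := by
      induction n with
      | zero =>
        rintro a rfl y hy hya
        rw [h.gradient_hatFeature_eq_projGradient hy hya, real_inner_comm]
        exact h.inner_gradient_hatFeature_projGradient hij hy hya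
      | succ n ihn =>
        intro a han y hy hya
        have hai : a < i.val := by omega
        obtain ⟨b, rfl⟩ : ∃ b : Fin M, b.val = a := ⟨⟨a, hai.trans i.2⟩, rfl⟩
        obtain ⟨γ, T, h0, hT, hγ⟩ := h.exists_normalizing_curve (lt_trans hai hij) hy hya
        have hend := ihn (b + 1) (by omega) (γ T) (hγ T right_mem_uIcc).1 hT
        have hmaps : MapsTo (fun t : ℝ => 1 - t) (Icc 0 1) (Icc 0 1) := fun t ht =>
          ⟨by linarith [ht.2], by linarith [ht.1]⟩
        -- Orthogonality is known at the end `γ T`, so the curve is run backwards over unit time,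
        -- which produces the factor `-T`.
        have := inner_gradient_eq_zero_of_integralCurve (κ := -T)
          (c := fun t => γ (T * (1 - t))) h.isOpen_narrowDomain
          (fun x hx => h.contDiffAt_hatFeature b hx) (fun x hx => h.contDiffAt_hatFeature i hx)
          (fun x hx => h.contDiffAt_hatFeature j hx) (ih b hai i hai)
          (ih b hai j (lt_trans hai hij)) (hbr b hai)
          (fun t ht => (hγ _ (mul_mem_uIcc_of_mem_Icc (hmaps ht))).1)
          (fun t ht => by
            obtain ⟨h1, h2, h3, -⟩ := hγ _ (mul_mem_uIcc_of_mem_Icc (T := T) (hmaps ht))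
            have h4 := HasDerivWithinAt.scomp t h3.comp_mul_Icc
              ((hasDerivWithinAt_id t (Icc (0 : ℝ) 1)).const_sub 1) hmaps
            refine h4.congr_deriv ?_
            rw [h.gradient_hatFeature_eq_projGradient h1 h2, neg_one_smul, neg_smul])
          (by simpa using hend)
        simpa [h0] using this
    intro x hx
    -- With `a = 0` the reference manifold is all of `Ω`.
    exact main i 0 (zero_add _) x hx ⟨hx.1, fun b hb => absurd hb (Nat.not_lt_zero _)⟩

theorem decoupledOn_hatFeature (h : IsRegularFamily Ω f) {i : Fin M}
    (hfrob : ∀ b ≤ i, 0 < b.val →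
      FrobeniusOn (hatFeature Ω f v) {c | c.val < b.val + 1} (narrowDomain Ω f v))
    {j : Fin M} (hij : i ≠ j) :
    DecoupledOn (hatFeature Ω f v i) (hatFeature Ω f v j) (narrowDomain Ω f v) := by
  refine fun x hx => ⟨(h.contDiffAt_hatFeature i hx).differentiableAt two_ne_zero,
    (h.contDiffAt_hatFeature j hx).differentiableAt two_ne_zero, ?_⟩
  -- The ordered statement is applied to the smaller of the two indices, so only Frobenius
  -- conditions up to `i` enter.
  rcases hij.lt_or_gt with hlt | hlt
  · exact h.inner_gradient_hatFeature i hfrob j hlt x hx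
  · rw [real_inner_comm]
    exact h.inner_gradient_hatFeature j (fun b hb => hfrob b (hb.trans hlt.le)) i hlt x hx

end IsRegularFamily

end Decoupling

theorem mainTheorem5 {N M : ℕ} (Ω : Set (Signal N)) (hΩ : IsOpen Ω)
    (f : Fin M → Signal N → ℝ) (hf : ∀ j, ContDiffOn ℝ 3 (f j) Ω)
    (hC1 : ∀ x ∈ Ω, LinearIndependent ℝ (fun j => gradient (f j) x))
    (v : Fin M → ℝ) :
    (∀ k : ℕ, k ≤ M →
      FrobeniusOn f {j | j.val < k} Ω →
      (∀ h : ℕ, h ≤ k →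
        FrobeniusOn (hatFeature Ω f v) {j | j.val < h} (narrowDomain Ω f v)) →
      ∀ i j : Fin M, i.val < k → i ≠ j →
        DecoupledOn (hatFeature Ω f v i) (hatFeature Ω f v j) (narrowDomain Ω f v)) ∧
    (∀ i j : Fin M, i.val = 0 → i ≠ j →
      DecoupledOn (hatFeature Ω f v i) (hatFeature Ω f v j) (narrowDomain Ω f v)) := by
  have hreg : IsRegularFamily Ω f := ⟨hΩ, hf, hC1⟩
  refine ⟨fun k _ _ hfrob i j hik hij => ?_, fun i j hi hij => ?_⟩
  · exact hreg.decoupledOn_hatFeature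
      (fun b hb _ => hfrob _ (Nat.succ_le_of_lt (lt_of_le_of_lt hb hik))) hij
  · exact hreg.decoupledOn_hatFeature
      -- For `i = 0` no `b ≤ i` has `0 < b`, so no Frobenius condition is needed.
      (fun b hb hb0 => absurd (Fin.le_def.1 hb) (by omega)) hij
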